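/- Let $\{\omega_x\}_{x\in\mathbb Z^2}$ be i.i.d. random variables with the rate-one exponential distribution, and let $e_1=(1,0)$, $e_2=(0,1)$. An up-right path is a finite or infinite sequence of points $x_k\in\mathbb Z^2$ with $x_{k+1}-x_k\in\{e_1,e_2\}$ for all $k$. A finite up-right path from $u$ to $v$ is a geodesic if it maximizes the sum of the weights $\omega_z$ over the points $z$ of the path (endpoints included) among all up-right paths from $u$ to $v$. A semi-infinite geodesic is an up-right path $(x_k)_{k\in\mathbb Z_{\ge 0}}$ such that for all $0\le m<n$ the segment $(x_k)_{k=m}^{n}$ is a geodesic from $x_m$ to $x_n$. The following holds with probability one. For each $i\in\{1,2\}$ and each $x\in\mathbb Z_{\ge0}^2$, the straight line $(x+ke_i)_{k\in\mathbb Z_{\ge0}}$ is a semi-infinite geodesic, and it is the only semi-infinite geodesic $(x_k)_{k\in\mathbb Z_{\ge0}}$ that satisfies $x_0=x$ and $\liminf_{k\to\infty}k^{-1}\,x_k\cdot e_{3-i}=0$. -/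

import Mathlib

open MeasureTheory ProbabilityTheory Filter

namespace CornerGrowth

/-- The planar integer lattice `ℤ²`; the coordinate indices `1, 2` are `0, 1 : Fin 2`, so that
`3 - i` becomes `i.rev`. -/
abbrev Site : Type := Fin 2 → ℤ

/-- The standard basis vector in coordinate direction `i`. -/
def e (i : Fin 2) : Site := Pi.single i 1

/-- The points `π 0, …, π n` form a nearest-neighbor up-right path with `n` steps from `x` to `y`
(so `n` is necessarily the `ℓ¹`-distance of `x` and `y`). Values `π k` with `k > n` play no role. -/
structure IsUpRightPath (x y : Site) (n : ℕ) (π : ℕ → Site) : Prop where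
  start : π 0 = x
  finish : π n = y
  step : ∀ k < n, ∃ j : Fin 2, π (k + 1) - π k = e j

/-- The total weight collected by `π 0, …, π n`, both endpoints included. -/
def passageTime (w : Site → ℝ) (n : ℕ) (π : ℕ → Site) : ℝ :=
  ∑ k ∈ Finset.range (n + 1), w (π k)

/-- `π 0, …, π n` is a (point-to-point) geodesic from `x` to `y`: it maximizes the total weight
among all up-right paths from `x` to `y`. -/
def IsGeodesic (w : Site → ℝ) (x y : Site) (n : ℕ) (π : ℕ → Site) : Prop :=
  IsUpRightPath x y n π ∧
    ∀ π' : ℕ → Site, IsUpRightPath x y n π' → passageTime w n π' ≤ passageTime w n π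

/-- A semi-infinite geodesic: an up-right path indexed by `ℕ`, each of whose finite segments
`γ m, …, γ (m + n)` is a geodesic between its endpoints. -/
structure IsSemiInfiniteGeodesic (w : Site → ℝ) (γ : ℕ → Site) : Prop where
  step : ∀ k, ∃ j : Fin 2, γ (k + 1) - γ k = e j
  segment : ∀ m n : ℕ, IsGeodesic w (γ m) (γ (m + n)) n (fun k => γ (m + k))

end CornerGrowth

/-!
Fix a starting point and call the direction `e_i` horizontal. A maximal path to a target that may
start with a vertical step may also do so after the target is moved up or left
(`StartsVertically.mono`); this is planarity. A semi-infinite geodesic that starts vertically and is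
horizontal along a subsequence therefore produces, for every `A`, vertical starts towards `(A j, j)`
for arbitrarily large `j`. It is enough to show that almost surely this fails for some `A`
(`ae_exists_not_startsVertically`); since this holds simultaneously at all sites, a geodesic that is
horizontal along a subsequence can never leave its initial line.

For the probability estimate, fix `α + β = 1` with `β` small and a far corner, and divide the
weights on the horizontal and vertical lines through the corner by `α` and `β`. This gives the
stationary field `Z`, whose increments along each row are independent exponentials of rate `α` by
the Burke property (`measurePreserving_burkeMap`, `exists_isBurkeFamily`). The paths of `Z` start
vertically at the origin with probability at most `β` (`measure_stationary_le`). If they start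
horizontally while some maximal path to `(A j, j)` starts vertically, the paths of `Z` have to pass
below this target, so that the increment of `Z` over the first `A j` columns of the bottom row is at
most the passage time to `(A j, j)` (`field_le_lpp_add`). The former grows like `A j / α`, whereas
for large `A` the latter is at most `c A j` with `c < 1 / α`; both deviations have probability
exponentially small in `j` (`measure_stationary_increment_le`, `measure_le_lpp_le`). Hence vertical
starts towards `(A j, j)` for some `j ≥ N` have probability at most `β` plus a geometric tail
(`exists_geometric_bound`). The corner lies beyond all the targets considered, so that a single
event of probability at most `β` covers them all, and neither limits of passage times nor Busemann
functions are needed. Letting `N → ∞` and then `β → 0` finishes the proof.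

All passage times are written in coordinates `(a, c)` counted from the target down and to the left,
in which they satisfy a recursion over `ℕ²`.
-/

namespace CornerGrowth

open scoped ENNReal

/-! ### Last-passage fields on the quadrant and their comparison -/

/-- `F` satisfies the last-passage recursion with weights `u` at every site of `ℕ²` off the axes;
the values on the axes are unconstrained. -/
def IsPassageField (u F : ℕ → ℕ → ℝ) : Prop :=
  ∀ a c, F (a + 1) (c + 1) = u (a + 1) (c + 1) + max (F a (c + 1)) (F (a + 1) c)

/-- Planar comparison of two last-passage fields with the same weights: if along the axes the
horizontal increments of `F` are at most those of `H`, and the vertical ones at least those of `H`,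
then the same holds on the whole quadrant. -/
theorem IsPassageField.comparison {u F H : ℕ → ℕ → ℝ} (hF : IsPassageField u F)
    (hH : IsPassageField u H) (hI : ∀ a, F (a + 1) 0 - F a 0 ≤ H (a + 1) 0 - H a 0)
    (hJ : ∀ c, H 0 (c + 1) - H 0 c ≤ F 0 (c + 1) - F 0 c) (a c : ℕ) :
    F (a + 1) c - F a c ≤ H (a + 1) c - H a c ∧ H a (c + 1) - H a c ≤ F a (c + 1) - F a c := by
  suffices h : ∀ c, (∀ a, F (a + 1) c - F a c ≤ H (a + 1) c - H a c) ∧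
      ∀ a, H a (c + 1) - H a c ≤ F a (c + 1) - F a c from ⟨(h c).1 a, (h c).2 a⟩
  have vert : ∀ c, (∀ a, F (a + 1) c - F a c ≤ H (a + 1) c - H a c) →
      ∀ a, H a (c + 1) - H a c ≤ F a (c + 1) - F a c := by
    intro c h a
    induction a with
    | zero => exact hJ c
    | succ a ih =>
      have := h a
      rw [hF, hH]
      rcases max_cases (F a (c + 1)) (F (a + 1) c) with h1 | h1 <;>
        rcases max_cases (H a (c + 1)) (H (a + 1) c) with h2 | h2 <;> linarith
  intro c
  induction c with
  | zero => exact ⟨hI, vert 0 hI⟩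
  | succ c ih =>
    have key : ∀ a, F (a + 1) (c + 1) - F a (c + 1) ≤ H (a + 1) (c + 1) - H a (c + 1) := by
      intro a
      have h3 := ih.1 a
      have h4 := ih.2 a
      rw [hF, hH]
      rcases max_cases (F a (c + 1)) (F (a + 1) c) with h1 | h1 <;>
        rcases max_cases (H a (c + 1)) (H (a + 1) c) with h2 | h2 <;> linarith
    exact ⟨key, vert (c + 1) key⟩

/-- The last-passage time from `(0, 0)` to `(a, c)` in the quadrant `ℕ²` with weights `u`, both
endpoints included, defined by its recursion. -/
noncomputable def lpp (u : ℕ → ℕ → ℝ) : ℕ → ℕ → ℝ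
  | 0, 0 => u 0 0
  | a + 1, 0 => u (a + 1) 0 + lpp u a 0
  | 0, c + 1 => u 0 (c + 1) + lpp u 0 c
  | a + 1, c + 1 => u (a + 1) (c + 1) + max (lpp u a (c + 1)) (lpp u (a + 1) c)

theorem isPassageField_lpp (u : ℕ → ℕ → ℝ) : IsPassageField u (lpp u) := fun a c => by
  rw [lpp]

theorem lpp_nonneg {u : ℕ → ℕ → ℝ} (hu : ∀ a c, 0 ≤ u a c) : ∀ a c, 0 ≤ lpp u a c
  | 0, 0 => by rw [lpp]; exact hu 0 0
  | a + 1, 0 => by rw [lpp]; exact add_nonneg (hu _ _) (lpp_nonneg hu a 0)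
  | 0, c + 1 => by rw [lpp]; exact add_nonneg (hu _ _) (lpp_nonneg hu 0 c)
  | a + 1, c + 1 => by
    rw [lpp]; exact add_nonneg (hu _ _) (le_max_of_le_left (lpp_nonneg hu a (c + 1)))

/-- The weights `w` seen from the site `(p, q)`, looking down and to the left. -/
def reflect (w : ℤ → ℤ → ℝ) (p q : ℤ) : ℕ → ℕ → ℝ := fun a c => w (p - a) (q - c)

/-- Among the up-right paths from `(0, 0)` to `(m + 1, n + 1)` with weights `w`, the best one whose
first step is vertical is at least as good as the best one whose first step is horizontal. The
passage times are read off from the reflected weights, so that `lpp (reflect w p q) a c` is the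
passage time from `(p - a, q - c)` to `(p, q)`. -/
def StartsVertically (w : ℤ → ℤ → ℝ) (m n : ℕ) : Prop :=
  lpp (reflect w (m + 1) (n + 1)) m (n + 1) ≤ lpp (reflect w (m + 1) (n + 1)) (m + 1) n

/-- By planarity, moving the target up keeps vertical starts. -/
theorem StartsVertically.up {w : ℤ → ℤ → ℝ} {m n : ℕ} (h : StartsVertically w m n) :
    StartsVertically w m (n + 1) := by
  unfold StartsVertically at *
  have hF := isPassageField_lpp (reflect w (m + 1) (n + 1))
  have hG := isPassageField_lpp (reflect w (m + 1) ((n + 1 : ℕ) + 1))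
  set G := lpp (reflect w (m + 1) ((n + 1 : ℕ) + 1)) with hGdef
  have hsh : ∀ a c : ℕ, reflect w (m + 1) ((n + 1 : ℕ) + 1) a (c + 1)
      = reflect w (m + 1) (n + 1) a c := by
    intro a c; simp only [reflect]; congr 1; push_cast; ring
  have hH : IsPassageField (reflect w (m + 1) (n + 1)) (fun a c => G a (c + 1)) := fun a c => by
    have := hG a (c + 1)
    rw [hsh] at this; exact this
  have := (hF.comparison hH ?_ ?_ m n)
  · have h1 := this.1; have h2 := this.2
    linarith
  · intro a
    have h1 := hG a 0
    have h2 := hsh (a + 1) 0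
    simp only [lpp] at h1 h2 ⊢
    have := le_max_left (G a 1) (G (a + 1) 0)
    simp only [zero_add] at *
    linarith
  · intro c
    have h2 := hsh 0 (c + 1)
    simp only [hGdef, lpp]
    linarith

/-- By planarity, moving the target to the left keeps vertical starts. -/
theorem StartsVertically.left {w : ℤ → ℤ → ℝ} {m n : ℕ} (h : StartsVertically w (m + 1) n) :
    StartsVertically w m n := by
  unfold StartsVertically at *
  have hH := isPassageField_lpp (reflect w (m + 1) (n + 1))
  have hG := isPassageField_lpp (reflect w ((m + 1 : ℕ) + 1) (n + 1))
  set G := lpp (reflect w ((m + 1 : ℕ) + 1) (n + 1)) with hGdef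
  have hsh : ∀ a c : ℕ, reflect w ((m + 1 : ℕ) + 1) (n + 1) (a + 1) c
      = reflect w (m + 1) (n + 1) a c := by
    intro a c; simp only [reflect]; congr 1; push_cast; ring
  have hF : IsPassageField (reflect w (m + 1) (n + 1)) (fun a c => G (a + 1) c) := fun a c => by
    have := hG (a + 1) c
    rw [hsh] at this; exact this
  have := (hF.comparison hH ?_ ?_ m n)
  · have h1 := this.1; have h2 := this.2
    linarith
  · intro a
    have h2 := hsh (a + 1) 0
    simp only [hGdef, lpp]
    linarith
  · intro c
    have h1 := hG 0 c
    have h2 := hsh 0 (c + 1)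
    simp only [lpp] at h1 h2 ⊢
    have := le_max_right (G 0 (c + 1)) (G 1 c)
    simp only [zero_add] at *
    linarith

theorem StartsVertically.mono {w : ℤ → ℤ → ℝ} {m n m' n' : ℕ} (h : StartsVertically w m n)
    (hm : m' ≤ m) (hn : n ≤ n') : StartsVertically w m' n' := by
  have h1 : StartsVertically w m' n := by
    induction m, hm using Nat.le_induction with
    | base => exact h
    | succ k _ ih => exact ih h.left
  induction n', hn using Nat.le_induction with
  | base => exact h1
  | succ k _ ih => exact ih.up

/-- Comparison with the terminal field `Z` on the row just beyond the target: the last-passage field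
of the paths that leave the quadrant (towards the target side) only through the row `c = 0`, where
the step out of column `a` collects the terminal value `b a`. -/
noncomputable def exitField (u : ℕ → ℕ → ℝ) (b : ℕ → ℝ) : ℕ → ℕ → ℝ
  | 0, 0 => u 0 0 + b 0
  | a + 1, 0 => u (a + 1) 0 + max (exitField u b a 0) (b (a + 1))
  | 0, c + 1 => u 0 (c + 1) + exitField u b 0 c
  | a + 1, c + 1 =>
    u (a + 1) (c + 1) + max (exitField u b a (c + 1)) (exitField u b (a + 1) c)

theorem isPassageField_exitField (u : ℕ → ℕ → ℝ) (b : ℕ → ℝ) :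
    IsPassageField u (exitField u b) := fun a c => by rw [exitField]

/-- Here `S` is a field on the quadrant extended by one row and one column, with values `b` on the
extra row and `d` on the extra column. -/
theorem exitField_le {u S : ℕ → ℕ → ℝ} {b d : ℕ → ℝ} (hS : IsPassageField u S)
    (h00 : S 0 0 = u 0 0 + max (d 0) (b 0))
    (hrow : ∀ a, S (a + 1) 0 = u (a + 1) 0 + max (S a 0) (b (a + 1)))
    (hcol : ∀ c, S 0 (c + 1) = u 0 (c + 1) + max (d (c + 1)) (S 0 c)) :
    ∀ a c, exitField u b a c ≤ S a c
  | 0, 0 => by rw [exitField, h00]; gcongr; exact le_max_right _ _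
  | a + 1, 0 => by
    rw [exitField, hrow]; gcongr; exact exitField_le hS h00 hrow hcol a 0
  | 0, c + 1 => by
    rw [exitField, hcol]; gcongr
    exact le_max_of_le_right (exitField_le hS h00 hrow hcol 0 c)
  | a + 1, c + 1 => by
    rw [exitField, hS]; gcongr
    · exact exitField_le hS h00 hrow hcol a (c + 1)
    · exact exitField_le hS h00 hrow hcol (a + 1) c

/-- The paths of `S` leave the quadrant through the extra row or, below height `n`, through the extra
column, where they collect at most `C`; in the second case their part inside the quadrant extends to
a path to `(0, 0)`. -/
theorem le_max_exitField {u S : ℕ → ℕ → ℝ} {b d : ℕ → ℝ} (hu : ∀ a c, 0 ≤ u a c)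
    (hS : IsPassageField u S)
    (h00 : S 0 0 = u 0 0 + max (d 0) (b 0))
    (hrow : ∀ a, S (a + 1) 0 = u (a + 1) 0 + max (S a 0) (b (a + 1)))
    (hcol : ∀ c, S 0 (c + 1) = u 0 (c + 1) + max (d (c + 1)) (S 0 c)) (n : ℕ) {C : ℝ}
    (hC : ∀ c ≤ n, d c ≤ C) :
    ∀ a c, c ≤ n → S a c ≤ max (exitField u b a c) (lpp u a c + C)
  | 0, 0, h => by
    rw [exitField, h00, lpp, ← max_add_add_left]
    have := hC 0 h
    exact max_le (le_max_of_le_right (by linarith)) (le_max_left _ _)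
  | a + 1, 0, h => by
    have ih := le_max_exitField hu hS h00 hrow hcol n hC a 0 h
    rw [exitField, hrow, lpp, ← max_add_add_left, ← max_add_add_left, add_assoc]
    refine max_le ?_ (le_max_of_le_left (le_max_right _ _))
    rcases le_max_iff.1 ih with h1 | h1
    · exact le_max_of_le_left (le_max_of_le_left (by linarith))
    · exact le_max_of_le_right (by linarith)
  | 0, c + 1, h => by
    have ih := le_max_exitField hu hS h00 hrow hcol n hC 0 c (by omega)
    have h0 := lpp_nonneg hu 0 c
    have h1 := hC (c + 1) h
    rw [exitField, hcol, lpp, ← max_add_add_left, add_assoc]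
    refine max_le (le_max_of_le_right (by linarith)) ?_
    rcases le_max_iff.1 ih with h1 | h1
    · exact le_max_of_le_left (by linarith)
    · exact le_max_of_le_right (by linarith)
  | a + 1, c + 1, h => by
    have ih1 := le_max_exitField hu hS h00 hrow hcol n hC a (c + 1) h
    have ih2 := le_max_exitField hu hS h00 hrow hcol n hC (a + 1) c (by omega)
    rw [exitField, hS, lpp, ← max_add_add_left, ← max_add_add_left, add_assoc,
      ← max_add_add_right, ← max_add_add_left]
    refine max_le ?_ ?_
    · rcases le_max_iff.1 ih1 with h1 | h1
      · exact le_max_of_le_left (le_max_of_le_left (by linarith))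
      · exact le_max_of_le_right (le_max_of_le_left (by linarith))
    · rcases le_max_iff.1 ih2 with h1 | h1
      · exact le_max_of_le_left (le_max_of_le_right (by linarith))
      · exact le_max_of_le_right (le_max_of_le_right (by linarith))

/-- If a maximal path from the origin to `(m + 1, n + 1)` may start vertically, while the maximal
paths of the field `Z` (rooted at the far corner `(m + 2 + s, n + 2 + t)`) start horizontally, then
by planarity the latter pass below the target, leaving the rectangle through its right side. This
bounds the increment of `Z` along the bottom row by the passage time to the target. -/
theorem field_le_lpp_add {w : ℤ → ℤ → ℝ} (hw : ∀ p q, 0 ≤ w p q) {Z : ℕ → ℕ → ℝ} {m n s t : ℕ}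
    {M L : ℤ} (hM : M = m + s + 2) (hL : L = n + t + 2)
    (hZ : IsPassageField (reflect w M L) Z) (hmono : Monotone (Z s))
    (hbad : StartsVertically w m n)
    (hgood : Z (s + m + 2) (t + n + 1) < Z (s + m + 1) (t + n + 2)) :
    Z (s + m + 2) (t + n + 2) ≤
      lpp (reflect w (m + 1) (n + 1)) (m + 1) (n + 1) + Z s (t + n + 2) := by
  subst hM hL
  set u := reflect w (m + 1) (n + 1) with hu
  have hu0 : ∀ a c, 0 ≤ u a c := fun a c => hw _ _
  have hZ' : ∀ a c a' c', a' = s + a + 1 → c' = t + c + 1 →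
      Z a' c' = u a c + max (Z (s + a) c') (Z a' (t + c)) := by
    rintro a c _ _ rfl rfl
    rw [hZ]
    have : reflect w (m + s + 2) (n + t + 2) (s + a + 1) (t + c + 1) = u a c := by
      simp only [hu, reflect]
      congr 1 <;> push_cast <;> ring
    rw [this]
  let S : ℕ → ℕ → ℝ := fun a c => Z (s + a + 1) (t + c + 1)
  let b : ℕ → ℝ := fun a => Z (s + a + 1) t
  let d : ℕ → ℝ := fun c => Z s (t + c + 1)
  have hS : IsPassageField u S := fun a c => hZ' (a + 1) (c + 1) _ _ rfl rfl
  have h00 : S 0 0 = u 0 0 + max (d 0) (b 0) := hZ' 0 0 _ _ rfl rfl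
  have hrow : ∀ a, S (a + 1) 0 = u (a + 1) 0 + max (S a 0) (b (a + 1)) :=
    fun a => hZ' (a + 1) 0 _ _ rfl rfl
  have hcol : ∀ c, S 0 (c + 1) = u 0 (c + 1) + max (d (c + 1)) (S 0 c) :=
    fun c => hZ' 0 (c + 1) _ _ rfl rfl
  have hlow := exitField_le hS h00 hrow hcol
  have hup := le_max_exitField hu0 hS h00 hrow hcol (n + 1) (C := d (n + 1))
    (fun c hc => hmono (by omega)) (m + 1) (n + 1) le_rfl
  -- a vertical start for the target is also a vertical start for the paths leaving through the top
  have hexit : exitField u b m (n + 1) ≤ exitField u b (m + 1) n := by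
    have := (isPassageField_lpp u).comparison (isPassageField_exitField u b) ?_ ?_ m n
    · have h1 := this.1; have h2 := this.2
      unfold StartsVertically at hbad
      rw [← hu] at hbad
      linarith
    · intro a
      simp only [lpp, exitField]
      have := le_max_left (exitField u b a 0) (b (a + 1))
      linarith
    · intro c
      simp only [lpp, exitField]
      linarith
  rcases le_max_iff.1 hup with h1 | h1
  · exfalso
    rw [isPassageField_exitField, max_eq_right hexit] at h1
    have h2 := hlow (m + 1) n
    have h3 := hS m n
    have h4 : S m (n + 1) ≤ max (S m (n + 1)) (S (m + 1) n) := le_max_left _ _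
    have h5 : S (m + 1) n < S m (n + 1) := hgood
    linarith
  · exact h1

/-! ### Exponential distributions and the Burke property -/

theorem measurable_exponentialPDF (r : ℝ) : Measurable (exponentialPDF r) :=
  (measurable_exponentialPDFReal r).ennreal_ofReal

theorem lintegral_expMeasure (r : ℝ) {f : ℝ → ℝ≥0∞} (hf : Measurable f) :
    ∫⁻ x, f x ∂(expMeasure r) = ∫⁻ x, exponentialPDF r x * f x := by
  rw [expMeasure, gammaMeasure]
  exact lintegral_withDensity_eq_lintegral_mul _ (measurable_exponentialPDF r) hf

theorem ae_pos_expMeasure {r : ℝ} (hr : 0 < r) : ∀ᵐ x ∂(expMeasure r), 0 < x := by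
  have := isProbabilityMeasure_expMeasure hr
  have h : expMeasure r (Set.Iic 0) = 0 := by
    have h1 := cdf_expMeasure_eq hr 0
    rw [cdf_eq_real] at h1
    simpa [Measure.real, ENNReal.toReal_eq_zero_iff] using h1
  rw [ae_iff]
  convert h using 2
  ext x; simp

/-- The moment generating function of the exponential distribution. -/
theorem lintegral_exp_expMeasure {r t : ℝ} (hr : 0 < r) (ht : t < r) :
    ∫⁻ x, ENNReal.ofReal (Real.exp (t * x)) ∂(expMeasure r) = ENNReal.ofReal (r / (r - t)) := by
  have h0 : 0 < r - t := by linarith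
  rw [lintegral_expMeasure _ (by fun_prop)]
  have : ∀ x, exponentialPDF r x * ENNReal.ofReal (Real.exp (t * x)) =
      ENNReal.ofReal (r / (r - t)) * exponentialPDF (r - t) x := by
    intro x
    rcases lt_or_ge x 0 with hx | hx
    · rw [exponentialPDF_of_neg hx, exponentialPDF_of_neg hx]; simp
    · rw [exponentialPDF_of_nonneg hx, exponentialPDF_of_nonneg hx,
        ← ENNReal.ofReal_mul (by positivity), ← ENNReal.ofReal_mul (by positivity)]
      congr 1
      rw [mul_assoc, ← Real.exp_add, ← mul_assoc, div_mul_cancel₀ _ h0.ne']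
      ring_nf
  simp_rw [this]
  rw [lintegral_const_mul _ (measurable_exponentialPDF _), lintegral_exponentialPDF_eq_one h0,
    mul_one]

theorem map_div_expMeasure {r : ℝ} (hr : 0 < r) :
    (expMeasure 1).map (fun x => x / r) = expMeasure r := by
  have := isProbabilityMeasure_expMeasure hr
  have := isProbabilityMeasure_expMeasure one_pos
  have hm : Measurable fun x : ℝ => x / r := by fun_prop
  have := Measure.isProbabilityMeasure_map (μ := expMeasure 1) hm.aemeasurable
  refine Measure.eq_of_cdf _ _ (StieltjesFunction.ext fun x => ?_)
  rw [cdf_expMeasure_eq hr, cdf_eq_real, map_measureReal_apply hm measurableSet_Iic]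
  have : (fun x : ℝ => x / r) ⁻¹' Set.Iic x = Set.Iic (r * x) := by
    ext y; simp [div_le_iff₀ hr, mul_comm]
  rw [this, ← cdf_eq_real, cdf_expMeasure_eq one_pos]
  simp [mul_nonneg_iff_of_pos_left hr]

/-- On the event that `I - J` lies in `D`, where `D` is the set of positive or of nonnegative reals,
the pair `(I, J)` of independent exponential variables of rates `a` and `b = 1 - a` has the law of
`(m + d, m)` with independent `m` of rate `1` and `d` of rate `a`, up to the factor `b`. -/
theorem lintegral_expMeasure_expMeasure_of_sub_mem {a b : ℝ} (ha : 0 < a) (hb : 0 < b)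
    (hab : a + b = 1) {D : Set ℝ} (hD : MeasurableSet D) (hpos : Set.Ioi 0 ⊆ D)
    (hnonneg : D ⊆ Set.Ici 0) {g : ℝ × ℝ → ℝ≥0∞} (hg : Measurable g) :
    ∫⁻ m, ∫⁻ i, D.indicator 1 (i - m) * g (i, m) ∂(expMeasure a) ∂(expMeasure b) =
      ENNReal.ofReal b * ∫⁻ m, ∫⁻ d, g (m + d, m) ∂(expMeasure a) ∂(expMeasure 1) := by
  have := isProbabilityMeasure_expMeasure ha
  have hpm := measurable_exponentialPDF
  have hD1 : Measurable (D.indicator (1 : ℝ → ℝ≥0∞)) := measurable_one.indicator hD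
  -- the densities factorize
  have hpdf : ∀ m d : ℝ, exponentialPDF b m * (exponentialPDF a (m + d) *
        (D.indicator 1 d * g (m + d, m))) =
      ENNReal.ofReal b * (exponentialPDF 1 m * (exponentialPDF a d *
        (D.indicator 1 d * g (m + d, m)))) := by
    intro m d
    by_cases hd : d ∈ D
    swap
    · simp [hd]
    have hd : 0 ≤ d := hnonneg hd
    rcases lt_or_ge m 0 with hm | hm
    · simp [exponentialPDF_of_neg hm]
    simp only [← mul_assoc]
    congr 2
    rw [exponentialPDF_of_nonneg hm, exponentialPDF_of_nonneg hm, exponentialPDF_of_nonneg hd,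
      exponentialPDF_of_nonneg (by positivity), ← ENNReal.ofReal_mul (by positivity),
      ← ENNReal.ofReal_mul (by positivity), ← ENNReal.ofReal_mul (by positivity)]
    congr 1
    have : Real.exp (-(1 * m)) = Real.exp (-(a * m)) * Real.exp (-(b * m)) := by
      rw [← Real.exp_add, ← hab]; ring_nf
    rw [this, mul_add, neg_add, Real.exp_add]
    ring
  have hinner : ∀ m, ∫⁻ d, g (m + d, m) ∂(expMeasure a) =
      ∫⁻ d, exponentialPDF a d * (D.indicator 1 d * g (m + d, m)) := by
    intro m
    rw [← lintegral_expMeasure a (by fun_prop)]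
    refine lintegral_congr_ae ?_
    filter_upwards [ae_pos_expMeasure ha] with d hd
    simp [hpos hd]
  simp_rw [hinner]
  rw [lintegral_expMeasure b, lintegral_expMeasure 1, ← lintegral_const_mul]
  · refine lintegral_congr fun m => ?_
    rw [lintegral_expMeasure a (by fun_prop), ← lintegral_add_left_eq_self _ m,
      ← lintegral_const_mul _ (by fun_prop), ← lintegral_const_mul _ (by fun_prop),
      ← lintegral_const_mul _ (by fun_prop)]
    refine lintegral_congr fun d => ?_
    rw [add_sub_cancel_left]
    exact hpdf m d
  · refine (hpm 1).mul (Measurable.lintegral_prod_right' (f := fun z : ℝ × ℝ =>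
      exponentialPDF a z.2 * (D.indicator 1 z.2 * g (z.1 + z.2, z.1))) ?_)
    fun_prop
  · refine Measurable.lintegral_prod_right' (f := fun z : ℝ × ℝ =>
      exponentialPDF a z.2 * (D.indicator 1 z.2 * g (z.1 + z.2, z.1))) ?_
    fun_prop
  · refine Measurable.lintegral_prod_right' (f := fun z : ℝ × ℝ =>
      (D.indicator 1 (z.2 - z.1) * g (z.2, z.1))) ?_
    fun_prop

/-- The pair `(I, J)` of independent exponential variables with rates adding up to one, described
through its minimum and its difference: the minimum is exponential of rate one and independent of
the difference, which is exponential of rate `α` with probability `β` and the negative of an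
exponential of rate `β` with probability `α`. -/
theorem expMeasure_prod_expMeasure {α β : ℝ} (hα : 0 < α) (hβ : 0 < β) (hαβ : α + β = 1) :
    (expMeasure α).prod (expMeasure β) =
      ENNReal.ofReal β • ((expMeasure α).prod (expMeasure 1)).map (fun z => (z.2 + z.1, z.2)) +
      ENNReal.ofReal α • ((expMeasure β).prod (expMeasure 1)).map (fun z => (z.2, z.2 + z.1)) := by
  have := isProbabilityMeasure_expMeasure hα
  have := isProbabilityMeasure_expMeasure hβ
  have := isProbabilityMeasure_expMeasure one_pos
  have hm1 : Measurable fun z : ℝ × ℝ => (z.2 + z.1, z.2) := by fun_prop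
  have hm2 : Measurable fun z : ℝ × ℝ => (z.2, z.2 + z.1) := by fun_prop
  have hI1 : Measurable ((Set.Ici (0 : ℝ)).indicator (1 : ℝ → ℝ≥0∞)) :=
    measurable_one.indicator measurableSet_Ici
  have hI2 : Measurable ((Set.Ioi (0 : ℝ)).indicator (1 : ℝ → ℝ≥0∞)) :=
    measurable_one.indicator measurableSet_Ioi
  refine Measure.ext_of_lintegral _ fun f hf => ?_
  have hsplit : ∀ z : ℝ × ℝ, f z = (Set.Ici 0).indicator 1 (z.1 - z.2) * f z +
      (Set.Ioi 0).indicator 1 (z.2 - z.1) * f z := by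
    intro z
    rcases le_or_gt z.2 z.1 with h | h
    · simp [Set.indicator, h, not_lt.2 h]
    · simp [Set.indicator, h, not_le.2 h]
  rw [lintegral_congr (μ := (expMeasure α).prod (expMeasure β)) hsplit,
    lintegral_add_left (by fun_prop), lintegral_prod_symm' _ (by fun_prop),
    lintegral_prod _ (by fun_prop), lintegral_add_measure, lintegral_smul_measure,
    lintegral_smul_measure, lintegral_map hf hm1, lintegral_map hf hm2,
    lintegral_prod_symm' _ (by fun_prop), lintegral_prod_symm' _ (by fun_prop)]
  congr 1
  · exact lintegral_expMeasure_expMeasure_of_sub_mem hα hβ hαβ measurableSet_Ici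
      Set.Ioi_subset_Ici_self subset_rfl hf
  · exact lintegral_expMeasure_expMeasure_of_sub_mem hβ hα (by rwa [add_comm]) measurableSet_Ioi
      subset_rfl Set.Ioi_subset_Ici_self (g := fun z => f (z.2, z.1)) (by fun_prop)

/-- For independent exponential variables `I` and `J` of rates `α` and `β = 1 - α`, the event
`J ≤ I` has probability at most `β`. -/
theorem expMeasure_prod_le {α β : ℝ} (hα : 0 < α) (hβ : 0 < β) (hαβ : α + β = 1) :
    (expMeasure α).prod (expMeasure β) {z | z.2 ≤ z.1} ≤ ENNReal.ofReal β := by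
  have := isProbabilityMeasure_expMeasure hα
  have := isProbabilityMeasure_expMeasure hβ
  have := isProbabilityMeasure_expMeasure one_pos
  have hm1 : Measurable fun z : ℝ × ℝ => (z.2 + z.1, z.2) := by fun_prop
  have hm2 : Measurable fun z : ℝ × ℝ => (z.2, z.2 + z.1) := by fun_prop
  have hS : MeasurableSet {z : ℝ × ℝ | z.2 ≤ z.1} := measurableSet_le measurable_snd measurable_fst
  have hzero : ((expMeasure β).prod (expMeasure 1)) {z : ℝ × ℝ | z.1 ≤ 0} = 0 := by
    have h : {z : ℝ × ℝ | z.1 ≤ 0} = {x : ℝ | x ≤ 0} ×ˢ Set.univ := by ext; simp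
    have h1 := ae_pos_expMeasure hβ
    rw [ae_iff] at h1
    simp only [not_lt] at h1
    rw [h, Measure.prod_prod, h1, zero_mul]
  rw [expMeasure_prod_expMeasure hα hβ hαβ, Measure.add_apply, Measure.smul_apply,
    Measure.smul_apply, Measure.map_apply hm1 hS, Measure.map_apply hm2 hS]
  have h2 : (fun z : ℝ × ℝ => (z.2, z.2 + z.1)) ⁻¹' {z | z.2 ≤ z.1} = {z : ℝ × ℝ | z.1 ≤ 0} := by
    ext z; simp
  rw [h2, hzero, smul_zero, add_zero, smul_eq_mul]
  exact mul_le_of_le_one_right' prob_le_one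

/-- One step of the last-passage recursion, in terms of increments: from the increments `I` (along
the near horizontal edge) and `J` (along the near vertical edge) of a unit square and the weight `X`
at its far corner, the increments along the two far edges, together with `min I J`, which makes the
map an involution. -/
def burkeMap (z : ℝ × ℝ × ℝ) : ℝ × ℝ × ℝ :=
  (z.2.2 + max (z.1 - z.2.1) 0, z.2.2 + max (z.2.1 - z.1) 0, min z.1 z.2.1)

@[fun_prop]
theorem measurable_burkeMap : Measurable burkeMap := by
  unfold burkeMap; fun_prop

/-- The Burke property: `burkeMap` preserves the product of exponential laws of rates `α`, `β`, `1`.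
In the coordinates `I - J`, `min I J`, `X` it exchanges the last two, which are identically
distributed, and the three coordinates are independent. -/
theorem measurePreserving_burkeMap {α β : ℝ} (hα : 0 < α) (hβ : 0 < β) (hαβ : α + β = 1) :
    MeasurePreserving burkeMap ((expMeasure α).prod ((expMeasure β).prod (expMeasure 1)))
      ((expMeasure α).prod ((expMeasure β).prod (expMeasure 1))) := by
  have := isProbabilityMeasure_expMeasure hα
  have := isProbabilityMeasure_expMeasure hβ
  have := isProbabilityMeasure_expMeasure one_pos
  refine ⟨measurable_burkeMap, Measure.ext_of_lintegral _ fun f hf => ?_⟩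
  have hfb := hf.comp measurable_burkeMap
  rw [lintegral_map hf measurable_burkeMap]
  have key : ∀ g : ℝ × ℝ × ℝ → ℝ≥0∞, Measurable g →
      ∫⁻ z, g z ∂((expMeasure α).prod ((expMeasure β).prod (expMeasure 1))) =
      ENNReal.ofReal β * ∫⁻ d, ∫⁻ m, ∫⁻ x, g (m + d, m, x) ∂(expMeasure 1) ∂(expMeasure 1)
        ∂(expMeasure α) +
      ENNReal.ofReal α * ∫⁻ d, ∫⁻ m, ∫⁻ x, g (m, m + d, x) ∂(expMeasure 1) ∂(expMeasure 1)
        ∂(expMeasure β) := by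
    intro g hg
    have hm1 : Measurable fun z : ℝ × ℝ => (z.2 + z.1, z.2) := by fun_prop
    have hm2 : Measurable fun z : ℝ × ℝ => (z.2, z.2 + z.1) := by fun_prop
    have hG : Measurable fun z : ℝ × ℝ => ∫⁻ x, g (z.1, z.2, x) ∂(expMeasure 1) :=
      Measurable.lintegral_prod_right' (f := fun w : (ℝ × ℝ) × ℝ => g (w.1.1, w.1.2, w.2))
        (by fun_prop)
    have : ∫⁻ z, g z ∂((expMeasure α).prod ((expMeasure β).prod (expMeasure 1))) =
        ∫⁻ z, ∫⁻ x, g (z.1, z.2, x) ∂(expMeasure 1) ∂((expMeasure α).prod (expMeasure β)) := by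
      rw [lintegral_prod _ hg.aemeasurable, lintegral_prod _ hG.aemeasurable]
      refine lintegral_congr fun i => ?_
      rw [lintegral_prod _ (by fun_prop)]
    rw [this, expMeasure_prod_expMeasure hα hβ hαβ, lintegral_add_measure, lintegral_smul_measure,
      lintegral_smul_measure, lintegral_map hG hm1, lintegral_map hG hm2]
    congr 2
    · exact lintegral_prod _ (hG.comp hm1).aemeasurable
    · exact lintegral_prod _ (hG.comp hm2).aemeasurable
  rw [key _ hf, key (fun z => f (burkeMap z)) hfb]
  congr 2
  · refine lintegral_congr_ae ?_
    filter_upwards [ae_pos_expMeasure hα] with d hd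
    rw [lintegral_lintegral_swap (by fun_prop)]
    refine lintegral_congr fun m => lintegral_congr fun x => ?_
    congr 1
    simp [burkeMap, hd.le]
  · refine lintegral_congr_ae ?_
    filter_upwards [ae_pos_expMeasure hβ] with d hd
    rw [lintegral_lintegral_swap (by fun_prop)]
    refine lintegral_congr fun m => lintegral_congr fun x => ?_
    congr 1
    simp [burkeMap, hd.le]

/-! ### Stationary last-passage percolation -/

/-- Replacing three members of an independent family by their image under a map that preserves their
joint law changes neither the independence of the family nor its marginals. -/
theorem iIndepFun_replace_three {ι Ω : Type*} [MeasurableSpace Ω] {P : Measure Ω}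
    [IsProbabilityMeasure P] {Y Y' : ι → Ω → ℝ} (hY : iIndepFun Y P) (hm : ∀ s, Measurable (Y s))
    {p q r : ι} (hpq : p ≠ q) (hpr : p ≠ r) (hqr : q ≠ r) {T : ℝ × ℝ × ℝ → ℝ × ℝ × ℝ}
    (hT : MeasurePreserving T ((P.map (Y p)).prod ((P.map (Y q)).prod (P.map (Y r))))
      ((P.map (Y p)).prod ((P.map (Y q)).prod (P.map (Y r)))))
    (hrep : ∀ a, (Y' p a, Y' q a, Y' r a) = T (Y p a, Y q a, Y r a))
    (hrest : ∀ s, s ≠ p → s ≠ q → s ≠ r → Y' s = Y s) :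
    iIndepFun Y' P ∧ (∀ s, Measurable (Y' s)) ∧ ∀ s, P.map (Y' s) = P.map (Y s) := by
  classical
  set V : Ω → ℝ × ℝ × ℝ := fun a => (Y p a, Y q a, Y r a) with hV
  set V' : Ω → ℝ × ℝ × ℝ := fun a => (Y' p a, Y' q a, Y' r a) with hV'
  have hVm : Measurable V := by fun_prop
  have hVV' : V' = T ∘ V := funext hrep
  have hV'm : Measurable V' := hVV' ▸ hT.measurable.comp hVm
  have hlaw : P.map V = (P.map (Y p)).prod ((P.map (Y q)).prod (P.map (Y r))) := by
    have h1 : IndepFun (Y p) (fun a => (Y q a, Y r a)) P :=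
      (hY.indepFun_prodMk hm q r p hpq.symm hpr.symm).symm
    have h2 : IndepFun (Y q) (Y r) P := hY.indepFun hqr
    rw [hV, (indepFun_iff_map_prod_eq_prod_map_map (hm p).aemeasurable (by fun_prop)).1 h1,
      (indepFun_iff_map_prod_eq_prod_map_map (hm q).aemeasurable (hm r).aemeasurable).1 h2]
  have hlaw' : P.map V' = P.map V := by
    rw [hVV', ← Measure.map_map hT.measurable hVm, hlaw, hT.map_eq]
  have hproj : ∀ g : ℝ × ℝ × ℝ → ℝ, Measurable g → P.map (g ∘ V') = P.map (g ∘ V) := by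
    intro g hg
    rw [← Measure.map_map hg hV'm, hlaw', Measure.map_map hg hVm]
  have hm' : ∀ s, Measurable (Y' s) := by
    intro s
    by_cases h1 : s = p
    · subst h1; exact hV'm.fst
    by_cases h2 : s = q
    · subst h2; exact hV'm.snd.fst
    by_cases h3 : s = r
    · subst h3; exact hV'm.snd.snd
    exact hrest s h1 h2 h3 ▸ hm s
  have hmarg : ∀ s, P.map (Y' s) = P.map (Y s) := by
    intro s
    by_cases h1 : s = p
    · subst h1; exact hproj _ measurable_fst
    by_cases h2 : s = q
    · subst h2; exact hproj (fun z => z.2.1) (by fun_prop)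
    by_cases h3 : s = r
    · subst h3; exact hproj (fun z => z.2.2) (by fun_prop)
    rw [hrest s h1 h2 h3]
  refine ⟨?_, hm', hmarg⟩
  rw [iIndepFun_iff_measure_inter_preimage_eq_mul]
  intro S A hA
  set R : Finset ι := S.filter fun s => s ≠ p ∧ s ≠ q ∧ s ≠ r with hR
  have hdisj : Disjoint ({p, q, r} : Finset ι) R := by
    rw [Finset.disjoint_left]
    intro s hs
    simp only [Finset.mem_insert, Finset.mem_singleton] at hs
    simp only [hR, Finset.mem_filter]
    tauto
  set U : Set (ℝ × ℝ × ℝ) :=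
    {z | (p ∈ S → z.1 ∈ A p) ∧ (q ∈ S → z.2.1 ∈ A q) ∧ (r ∈ S → z.2.2 ∈ A r)} with hU
  have hUm : MeasurableSet U := by
    have himp : ∀ (c : ι) (g : ℝ × ℝ × ℝ → ℝ), Measurable g →
        MeasurableSet {z | c ∈ S → g z ∈ A c} := by
      intro c g hg
      by_cases hc : c ∈ S
      · simp only [hc, true_imp_iff]; exact hg (hA c hc)
      · simp [hc]
    exact (himp p _ measurable_fst).inter
      ((himp q (fun z => z.2.1) (by fun_prop)).inter (himp r (fun z => z.2.2) (by fun_prop)))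
  set E : Set Ω := ⋂ s ∈ R, Y s ⁻¹' A s with hE
  have hindep : ∀ W : Set (ℝ × ℝ × ℝ), MeasurableSet W → P (V ⁻¹' W ∩ E) = P (V ⁻¹' W) * P E := by
    intro W hW
    have h := (hY.indepFun_finset _ _ hdisj hm).comp
      (φ := fun v : ({p, q, r} : Finset ι) → ℝ =>
        (v ⟨p, by simp⟩, v ⟨q, by simp⟩, v ⟨r, by simp⟩)) (ψ := id)
      (by fun_prop) measurable_id
    have h2 := h.measure_inter_preimage_eq_mul W {v | ∀ s : R, v s ∈ A s} hW ?_
    · have h3 : (id ∘ fun a (s : R) => Y s a) ⁻¹' {v | ∀ s : R, v s ∈ A s} = E := by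
        ext a; simp [hE]
      rw [h3] at h2
      exact h2
    · have : {v : R → ℝ | ∀ s : R, v s ∈ A s} = Set.univ.pi fun s : R => A s := by
        ext; simp
      rw [this]
      exact MeasurableSet.univ_pi fun s => hA s (Finset.mem_filter.1 s.2).1
  have hsplit : ∀ X : ι → Ω → ℝ, (∀ s, s ≠ p → s ≠ q → s ≠ r → X s = Y s) →
      ⋂ s ∈ S, X s ⁻¹' A s = (fun a => (X p a, X q a, X r a)) ⁻¹' U ∩ E := by
    intro X hX
    ext a
    simp only [hU, hE, hR, Set.mem_iInter, Set.mem_preimage, Set.mem_inter_iff, Set.mem_ofPred_eq,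
      Finset.mem_filter]
    constructor
    · intro h
      refine ⟨⟨h p, h q, h r⟩, fun s hs => ?_⟩
      have := h s hs.1
      rwa [hX s hs.2.1 hs.2.2.1 hs.2.2.2] at this
    · rintro ⟨⟨h1, h2, h3⟩, h4⟩ s hs
      by_cases e1 : s = p
      · subst e1; exact h1 hs
      by_cases e2 : s = q
      · subst e2; exact h2 hs
      by_cases e3 : s = r
      · subst e3; exact h3 hs
      rw [hX s e1 e2 e3]
      exact h4 s ⟨hs, e1, e2, e3⟩
  calc P (⋂ s ∈ S, Y' s ⁻¹' A s) = P (V' ⁻¹' U ∩ E) := by rw [hsplit Y' hrest]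
    _ = P (V' ⁻¹' U) * P E := by
      rw [hVV', Set.preimage_comp, hindep _ (hT.measurable hUm)]
    _ = P (V ⁻¹' U) * P E := by
      rw [← Measure.map_apply hV'm hUm, hlaw', Measure.map_apply hVm hUm]
    _ = P (⋂ s ∈ S, Y s ⁻¹' A s) := by rw [← hindep U hUm, hsplit Y fun _ _ _ _ => rfl]
    _ = ∏ s ∈ S, P (Y s ⁻¹' A s) := hY.measure_inter_preimage_eq_mul S hA
    _ = ∏ s ∈ S, P (Y' s ⁻¹' A s) := by
      refine Finset.prod_congr rfl fun s hs => ?_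
      rw [← Measure.map_apply (hm s) (hA s hs), ← hmarg s, Measure.map_apply (hm' s) (hA s hs)]

/-- Last-passage percolation from `(0, 0)` with weights `u` off the axes, where the weights on the
horizontal and on the vertical axis are divided by `α` and `β`. For independent exponential weights
of rate one and `α + β = 1` this is the stationary model, see `exists_isBurkeFamily`. -/
noncomputable def stationary (α β : ℝ) (u : ℕ → ℕ → ℝ) : ℕ → ℕ → ℝ
  | 0, 0 => 0
  | a + 1, 0 => stationary α β u a 0 + u (a + 1) 0 / α
  | 0, c + 1 => stationary α β u 0 c + u 0 (c + 1) / β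
  | a + 1, c + 1 =>
    u (a + 1) (c + 1) + max (stationary α β u a (c + 1)) (stationary α β u (a + 1) c)

theorem isPassageField_stationary (α β : ℝ) (u : ℕ → ℕ → ℝ) :
    IsPassageField u (stationary α β u) := fun a c => by rw [stationary]

theorem monotone_stationary {α β : ℝ} (hβ : 0 < β) {u : ℕ → ℕ → ℝ} (hu : ∀ a c, 0 ≤ u a c)
    (a : ℕ) : Monotone (stationary α β u a) := by
  refine monotone_nat_of_le_succ fun c => ?_
  cases a with
  | zero => rw [stationary]; exact le_add_of_nonneg_right (div_nonneg (hu _ _) hβ.le)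
  | succ a =>
    rw [stationary]
    exact (le_max_right _ _).trans (le_add_of_nonneg_left (hu _ _))

section Stationary

variable {Ω : Type*} [MeasurableSpace Ω] {P : Measure Ω}

/-- The independent family kept along a row-by-row sweep of the quadrant, after the rows up to `c`
and the first `a` columns of row `c + 1` have been treated. Slot `(k + 1, 0)` holds the increment of
the stationary field across column `k` on the last row treated there, slot `(0, l + 1)` holds the
increment from row `l` to row `l + 1` in the last column treated there, and the slots of the sites
not yet reached hold the weights of these sites. Only the columns below `m` are swept. -/
structure IsBurkeFamily (P : Measure Ω) (α β : ℝ) (X : ℕ → ℕ → Ω → ℝ) (m c a : ℕ)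
    (Y : ℕ × ℕ → Ω → ℝ) : Prop where
  indep : iIndepFun Y P
  meas : ∀ s, Measurable (Y s)
  law_row : ∀ k, P.map (Y (k + 1, 0)) = expMeasure α
  law_col : ∀ l, P.map (Y (0, l + 1)) = expMeasure β
  law_bulk : ∀ k l, P.map (Y (k + 1, l + 1)) = expMeasure 1
  row_new : ∀ k < a, ∀ ω, Y (k + 1, 0) ω =
    stationary α β (fun i j => X i j ω) (k + 1) (c + 1) -
      stationary α β (fun i j => X i j ω) k (c + 1)
  row_old : ∀ k, a ≤ k → k < m → ∀ ω, Y (k + 1, 0) ω =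
    stationary α β (fun i j => X i j ω) (k + 1) c - stationary α β (fun i j => X i j ω) k c
  col_cur : ∀ ω, Y (0, c + 1) ω =
    stationary α β (fun i j => X i j ω) a (c + 1) - stationary α β (fun i j => X i j ω) a c
  col_next : ∀ l, c < l → ∀ ω, Y (0, l + 1) ω =
    stationary α β (fun i j => X i j ω) 0 (l + 1) - stationary α β (fun i j => X i j ω) 0 l
  bulk : ∀ k l, (c < l ∨ l = c ∧ a ≤ k) → Y (k + 1, l + 1) = X (k + 1) (l + 1)

variable {α β : ℝ} {X : ℕ → ℕ → Ω → ℝ} {m c a : ℕ} {Y : ℕ × ℕ → Ω → ℝ}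

/-- The sweep advances by one column: `burkeMap` is applied to the slots of the two increments and of
the weight of the unit square at `(a, c)`. -/
theorem IsBurkeFamily.exists_step [IsProbabilityMeasure P] (hα : 0 < α) (hβ : 0 < β)
    (hαβ : α + β = 1) (h : IsBurkeFamily P α β X m c a Y) (ha : a < m) :
    ∃ Y', IsBurkeFamily P α β X m c (a + 1) Y' := by
  classical
  let T : Ω → ℝ × ℝ × ℝ := fun ω =>
    burkeMap (Y (a + 1, 0) ω, Y (0, c + 1) ω, Y (a + 1, c + 1) ω)
  let Y' : ℕ × ℕ → Ω → ℝ := fun s ω =>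
    if s = (a + 1, 0) then (T ω).1 else if s = (0, c + 1) then (T ω).2.1
    else if s = (a + 1, c + 1) then (T ω).2.2 else Y s ω
  have hZ := fun ω => isPassageField_stationary α β (fun i j => X i j ω) a c
  obtain ⟨h1, h2, h3⟩ := iIndepFun_replace_three (Y' := Y') h.indep h.meas
    (p := (a + 1, 0)) (q := (0, c + 1)) (r := (a + 1, c + 1)) (by simp) (by simp) (by simp)
    (T := burkeMap)
    (by rw [h.law_row, h.law_col, h.law_bulk]; exact measurePreserving_burkeMap hα hβ hαβ)
    (fun ω => by simp [Y', T])
    (fun s e1 e2 e3 => by funext ω; simp [Y', e1, e2, e3])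
  have hI := h.row_old a le_rfl ha
  have hJ := h.col_cur
  have hX := h.bulk a c (Or.inr ⟨rfl, le_rfl⟩)
  refine ⟨Y', h1, h2, fun k => (h3 _).trans (h.law_row k), fun l => (h3 _).trans (h.law_col l),
    fun k l => (h3 _).trans (h.law_bulk k l), ?_, ?_, ?_, ?_, ?_⟩
  · intro k hk ω
    rcases eq_or_ne k a with rfl | hka
    · simp only [Y', T, burkeMap, if_true]
      rw [hI, hJ, hX, hZ]
      rcases max_cases (stationary α β (fun i j => X i j ω) k (c + 1))
        (stationary α β (fun i j => X i j ω) (k + 1) c) with e1 | e1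
      · rw [max_eq_right (by linarith)]; linarith
      · rw [max_eq_left (by linarith)]; linarith
    · have : Y' (k + 1, 0) ω = Y (k + 1, 0) ω := by simp [Y', hka]
      rw [this, h.row_new k (by omega)]
  · intro k hk hkm ω
    have : Y' (k + 1, 0) ω = Y (k + 1, 0) ω := by
      have : k ≠ a := by omega
      simp [Y', this]
    rw [this, h.row_old k (by omega) hkm]
  · intro ω
    have : Y' (0, c + 1) ω = (T ω).2.1 := by simp [Y']
    rw [this]
    simp only [T, burkeMap]
    rw [hI, hJ, hX, hZ]
    rcases max_cases (stationary α β (fun i j => X i j ω) a (c + 1))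
      (stationary α β (fun i j => X i j ω) (a + 1) c) with e1 | e1
    · rw [max_eq_left (by linarith)]; linarith
    · rw [max_eq_right (by linarith)]; linarith
  · intro l hl ω
    have : Y' (0, l + 1) ω = Y (0, l + 1) ω := by
      have : l ≠ c := by omega
      simp [Y', this]
    rw [this, h.col_next l hl]
  · intro k l hkl
    have : Y' (k + 1, l + 1) = Y (k + 1, l + 1) := by
      funext ω
      have : ¬ (k = a ∧ l = c) := by omega
      simp [Y', this]
    rw [this, h.bulk k l (by omega)]

/-- In the stationary model the sweep can be carried out; in particular the increments along any row
are independent exponential variables of rate `α`. -/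
theorem exists_isBurkeFamily [IsProbabilityMeasure P] (hα : 0 < α) (hβ : 0 < β) (hαβ : α + β = 1)
    (hX : iIndepFun (fun s : ℕ × ℕ => X s.1 s.2) P) (hXm : ∀ i j, Measurable (X i j))
    (hlaw : ∀ i j, P.map (X i j) = expMeasure 1) (m c a : ℕ) (ha : a ≤ m) :
    ∃ Y, IsBurkeFamily P α β X m c a Y := by
  have hrow : ∀ c, (∃ Y, IsBurkeFamily P α β X m c 0 Y) → ∀ a ≤ m,
      ∃ Y, IsBurkeFamily P α β X m c a Y := by
    intro c h0 a
    induction a with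
    | zero => exact fun _ => h0
    | succ a ih =>
      intro ha
      obtain ⟨Y, hY⟩ := ih (by omega)
      exact hY.exists_step hα hβ hαβ (by omega)
  refine hrow c ?_ a ha
  clear ha a
  induction c with
  | zero =>
    let g : ℕ × ℕ → ℝ → ℝ := fun s x => if s.2 = 0 then x / α else if s.1 = 0 then x / β else x
    have hg : ∀ s, Measurable (g s) := by
      intro s
      by_cases h1 : s.2 = 0
      · simp only [g, h1, if_true]; fun_prop
      by_cases h2 : s.1 = 0
      · simp only [g, h1, h2, if_true, if_false]; fun_prop
      · simp only [g, h1, h2, if_false]; fun_prop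
    have hmap : ∀ s : ℕ × ℕ, P.map (g s ∘ X s.1 s.2) = (expMeasure 1).map (g s) := by
      intro s
      rw [← Measure.map_map (hg s) (hXm _ _), hlaw]
    refine ⟨fun s => g s ∘ X s.1 s.2, hX.comp g hg, fun s => (hg s).comp (hXm _ _),
      fun k => ?_, fun l => ?_, fun k l => ?_, ?_, ?_, ?_, ?_, ?_⟩
    · rw [hmap]; simpa [g] using map_div_expMeasure hα
    · rw [hmap]; simpa [g] using map_div_expMeasure hβ
    · rw [hmap]; simp [g]
    · intro k hk; omega
    · intro k _ _ ω
      simp [g, stationary]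
    · intro ω; simp [g, stationary]
    · intro l _ ω; simp [g, stationary]
    · intro k l _
      funext ω
      simp [g]
  | succ c ih =>
    obtain ⟨Y, hY⟩ := hrow c ih m le_rfl
    exact ⟨Y, hY.indep, hY.meas, hY.law_row, hY.law_col, hY.law_bulk, fun k hk => by omega,
      fun k _ hk => hY.row_new k hk, hY.col_next (c + 1) (by omega),
      fun l hl => hY.col_next l (by omega), fun k l hkl => hY.bulk k l (by omega)⟩

end Stationary

/-! ### Tail bounds -/

theorem measurable_lpp {Ω : Type*} {m' : MeasurableSpace Ω} {X : ℕ → ℕ → Ω → ℝ} :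
    ∀ {a c : ℕ},
    (∀ i ≤ a, ∀ j ≤ c, Measurable[m'] (X i j)) →
      Measurable[m'] fun ω => lpp (fun i j => X i j ω) a c
  | 0, 0, h => by simp only [lpp]; exact h 0 le_rfl 0 le_rfl
  | a + 1, 0, h => by
    simp only [lpp]
    exact (h _ le_rfl _ le_rfl).add (measurable_lpp fun i hi => h i (by omega))
  | 0, c + 1, h => by
    simp only [lpp]
    exact (h _ le_rfl _ le_rfl).add (measurable_lpp fun i hi j hj => h i hi j (by omega))
  | a + 1, c + 1, h => by
    simp only [lpp]
    exact (h _ le_rfl _ le_rfl).add ((measurable_lpp fun i hi => h i (by omega)).max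
      (measurable_lpp fun i hi j hj => h i hi j (by omega)))

/-- Exponential moments factorize when a weight is added to a function `F` of the other weights. -/
theorem lintegral_exp_mul_add {ι Ω : Type*} [MeasurableSpace Ω] {P : Measure Ω}
    {W : ι → Ω → ℝ} (hW : iIndepFun W P) (hWm : ∀ s, Measurable (W s))
    (hlaw : ∀ s, P.map (W s) = expMeasure 1) {θ : ℝ} (hθ : θ < 1) (t : ι) {F : Ω → ℝ}
    (hF : Measurable[⨆ s ∈ ({t}ᶜ : Set ι), MeasurableSpace.comap (W s) inferInstance] F) :
    ∫⁻ ω, ENNReal.ofReal (Real.exp (θ * (W t ω + F ω))) ∂P =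
      ENNReal.ofReal (1 / (1 - θ)) * ∫⁻ ω, ENNReal.ofReal (Real.exp (θ * F ω)) ∂P := by
  have hle : ∀ s, MeasurableSpace.comap (W s) inferInstance ≤ ‹MeasurableSpace Ω› :=
    fun s => (hWm s).comap_le
  have hFm : Measurable F := hF.mono (iSup₂_le fun s _ => hle s) le_rfl
  have hind : IndepFun (W t) F P := by
    have h := indep_iSup_of_disjoint hle hW.iIndep (S := {t}) (T := {t}ᶜ) disjoint_compl_right
    rw [IndepFun_iff_Indep]
    refine indep_of_indep_of_le_right (indep_of_indep_of_le_left h ?_) hF.comap_le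
    exact le_iSup₂_of_le t rfl le_rfl
  have hφ : Measurable fun x : ℝ => ENNReal.ofReal (Real.exp (θ * x)) := by fun_prop
  have h2 := lintegral_mul_eq_lintegral_mul_lintegral_of_indepFun (hφ.comp (hWm t)) (hφ.comp hFm)
    (hind.comp hφ hφ)
  have h1 := lintegral_exp_expMeasure one_pos hθ
  rw [← hlaw t, lintegral_map hφ (hWm t)] at h1
  rw [← h1]
  refine Eq.trans (lintegral_congr fun ω => ?_) h2
  simp only [Pi.mul_apply, Function.comp_apply]
  rw [← ENNReal.ofReal_mul (Real.exp_pos _).le, ← Real.exp_add, mul_add]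

section Tails

variable {Ω : Type*} [MeasurableSpace Ω] {P : Measure Ω} [IsProbabilityMeasure P]
  {X : ℕ → ℕ → Ω → ℝ}

/-- In the stationary model a maximal path from `(0, 0)` arrives at `(m + 1, n + 1)` by a vertical
step with probability at most `β`. -/
theorem measure_stationary_le {α β : ℝ} (hα : 0 < α) (hβ : 0 < β) (hαβ : α + β = 1)
    (hX : iIndepFun (fun s : ℕ × ℕ => X s.1 s.2) P) (hXm : ∀ i j, Measurable (X i j))
    (hlaw : ∀ i j, P.map (X i j) = expMeasure 1) (m n : ℕ) :
    P {ω | stationary α β (fun i j => X i j ω) m (n + 1) ≤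
      stationary α β (fun i j => X i j ω) (m + 1) n} ≤ ENNReal.ofReal β := by
  obtain ⟨Y, hY⟩ := exists_isBurkeFamily hα hβ hαβ hX hXm hlaw (m + 1) n m (by omega)
  have hind : IndepFun (Y (m + 1, 0)) (Y (0, n + 1)) P := hY.indep.indepFun (by simp)
  have hlaw2 := hind.map_prod_eq_prod_map_map (hY.meas _).aemeasurable (hY.meas _).aemeasurable
  rw [hY.law_row, hY.law_col] at hlaw2
  refine le_trans (le_of_eq ?_) (expMeasure_prod_le hα hβ hαβ)
  rw [← hlaw2, Measure.map_apply ((hY.meas _).prodMk (hY.meas _))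
    (measurableSet_le measurable_snd measurable_fst)]
  congr 1
  ext ω
  simp only [Set.mem_ofPred_eq, Set.mem_preimage]
  rw [hY.col_cur, hY.row_old m le_rfl (by omega)]
  simp

/-- Chernoff bound for the lower tail of the row increments of the stationary model, which are sums
of independent exponential variables of rate `α`. -/
theorem measure_stationary_increment_le {α β : ℝ} (hα : 0 < α) (hβ : 0 < β) (hαβ : α + β = 1)
    (hX : iIndepFun (fun s : ℕ × ℕ => X s.1 s.2) P) (hXm : ∀ i j, Measurable (X i j))
    (hlaw : ∀ i j, P.map (X i j) = expMeasure 1) (k r n : ℕ) {θ : ℝ} (hθ : 0 < θ) (x : ℝ) :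
    P {ω | stationary α β (fun i j => X i j ω) (k + r) n -
      stationary α β (fun i j => X i j ω) k n ≤ x} ≤
      ENNReal.ofReal (Real.exp (θ * x) * (α / (α + θ)) ^ r) := by
  obtain ⟨Y, hY⟩ := exists_isBurkeFamily hα hβ hαβ hX hXm hlaw (k + r) n 0 (by omega)
  set S : Ω → ℝ := fun ω => ∑ i ∈ Finset.range r, Y (k + i + 1, 0) ω with hS
  have hsum : ∀ ω, stationary α β (fun i j => X i j ω) (k + r) n -
      stationary α β (fun i j => X i j ω) k n = S ω := by
    intro ω
    rw [hS]
    simp only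
    rw [Finset.sum_congr rfl fun i hi => hY.row_old (k + i) (by omega)
      (by have := Finset.mem_range.1 hi; omega) ω]
    exact (Finset.sum_range_sub (fun i => stationary α β (fun i j => X i j ω) (k + i) n) r).symm
  have hmgf : ∫⁻ ω, ENNReal.ofReal (Real.exp (-θ * S ω)) ∂P =
      ENNReal.ofReal ((α / (α + θ)) ^ r) := by
    have hfac : ∀ ω, ENNReal.ofReal (Real.exp (-θ * S ω)) =
        ∏ i ∈ Finset.range r, ENNReal.ofReal (Real.exp (-θ * Y (k + i + 1, 0) ω)) := by
      intro ω
      rw [hS, Finset.mul_sum, Real.exp_sum, ENNReal.ofReal_prod_of_nonneg]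
      exact fun _ _ => (Real.exp_pos _).le
    have hinj : Function.Injective fun i : ℕ => (k + i + 1, 0) := by
      intro i j hij; simpa using hij
    have hind := (hY.indep.precomp hinj).comp
      (fun _ x => ENNReal.ofReal (Real.exp (-θ * x))) (fun _ => by fun_prop)
    rw [lintegral_congr hfac]
    refine (lintegral_prod_eq_prod_lintegral_of_indepFun (Finset.range r) _ hind
      (fun i => ?_)).trans ?_
    · exact (by fun_prop : Measurable fun x : ℝ => ENNReal.ofReal (Real.exp (-θ * x))).comp
        (hY.meas _)
    · have : ∀ i, ∫⁻ ω, ((fun x => ENNReal.ofReal (Real.exp (-θ * x))) ∘ Y (k + i + 1, 0)) ω ∂P =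
          ENNReal.ofReal (α / (α + θ)) := by
        intro i
        have h1 := lintegral_exp_expMeasure hα (t := -θ) (by linarith)
        rw [← hY.law_row (k + i), lintegral_map (by fun_prop) (hY.meas _), sub_neg_eq_add] at h1
        exact h1
      refine (Finset.prod_congr rfl fun i _ => this i).trans ?_
      rw [Finset.prod_const, Finset.card_range, ENNReal.ofReal_pow (by positivity)]
  have hSm : Measurable S := Finset.measurable_fun_sum _ fun i _ => hY.meas _
  calc P {ω | stationary α β (fun i j => X i j ω) (k + r) n -
        stationary α β (fun i j => X i j ω) k n ≤ x}
      ≤ P {ω | ENNReal.ofReal (Real.exp (-θ * x)) ≤ ENNReal.ofReal (Real.exp (-θ * S ω))} := by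
        refine measure_mono fun ω hω => ?_
        simp only [Set.mem_ofPred_eq, hsum] at hω ⊢
        exact ENNReal.ofReal_le_ofReal (Real.exp_le_exp.2 (by nlinarith))
    _ ≤ (∫⁻ ω, ENNReal.ofReal (Real.exp (-θ * S ω)) ∂P) / ENNReal.ofReal (Real.exp (-θ * x)) :=
        meas_ge_le_lintegral_div (by fun_prop) (by simp [Real.exp_pos]) ENNReal.ofReal_ne_top
    _ = ENNReal.ofReal (Real.exp (θ * x) * (α / (α + θ)) ^ r) := by
        rw [hmgf, ← ENNReal.ofReal_div_of_pos (Real.exp_pos _)]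
        congr 1
        rw [neg_mul, Real.exp_neg, div_inv_eq_mul, mul_comm]

/-- An exponential moment bound for last-passage times, from bounding the exponential of a maximum
by the sum of the exponentials in the recursion. -/
theorem lintegral_exp_lpp_le (hX : iIndepFun (fun s : ℕ × ℕ => X s.1 s.2) P)
    (hXm : ∀ i j, Measurable (X i j)) (hlaw : ∀ i j, P.map (X i j) = expMeasure 1)
    {θ ρ σ : ℝ} (hθ : θ < 1) (hρ : 0 < ρ) (hσ : 0 < σ) (h : 1 / ρ + 1 / σ ≤ 1 - θ) :
    ∀ a c, ∫⁻ ω, ENNReal.ofReal (Real.exp (θ * lpp (fun i j => X i j ω) a c)) ∂P ≤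
      ENNReal.ofReal (1 / (1 - θ) * (ρ ^ a * σ ^ c)) := by
  have hθ' : 0 < 1 - θ := by linarith
  have hρ' : 0 < 1 / ρ := by positivity
  have hσ' : 0 < 1 / σ := by positivity
  have hκρ : 1 / (1 - θ) ≤ ρ := by
    rw [one_div_le hθ' hρ]; linarith
  have hκσ : 1 / (1 - θ) ≤ σ := by
    rw [one_div_le hθ' hσ]; linarith
  have hstep : ∀ (t : ℕ × ℕ) (F : Ω → ℝ),
      Measurable[⨆ s ∈ ({t}ᶜ : Set (ℕ × ℕ)),
        MeasurableSpace.comap (X s.1 s.2) inferInstance] F →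
      ∫⁻ ω, ENNReal.ofReal (Real.exp (θ * (X t.1 t.2 ω + F ω))) ∂P =
        ENNReal.ofReal (1 / (1 - θ)) * ∫⁻ ω, ENNReal.ofReal (Real.exp (θ * F ω)) ∂P :=
    fun t F hF => lintegral_exp_mul_add hX (fun s => hXm s.1 s.2) (fun s => hlaw s.1 s.2) hθ t hF
  have hmeas : ∀ (t : ℕ × ℕ) (a c : ℕ), (a < t.1 ∨ c < t.2) →
      Measurable[⨆ s ∈ ({t}ᶜ : Set (ℕ × ℕ)),
        MeasurableSpace.comap (X s.1 s.2) inferInstance]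
        fun ω => lpp (fun i j => X i j ω) a c := by
    intro t a c hac
    refine measurable_lpp fun i hi j hj => ?_
    refine Measurable.of_comap_le (le_iSup₂_of_le (i, j) ?_ le_rfl)
    rintro rfl
    simp only at hac
    omega
  intro a
  induction a with
  | zero =>
    intro c
    induction c with
    | zero =>
      have := hstep (0, 0) (fun _ => 0) (@measurable_const _ _ _ _ 0)
      simp only [lpp]
      simpa using this.le
    | succ c ih =>
      simp only [lpp]
      rw [hstep (0, c + 1) _ (hmeas _ _ _ (by simp))]
      refine (mul_le_mul_right ih _).trans ?_
      rw [← ENNReal.ofReal_mul (by positivity)]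
      refine ENNReal.ofReal_le_ofReal ?_
      rw [pow_succ, pow_zero, one_mul, one_mul]
      have : 1 / (1 - θ) * σ ^ c ≤ σ * σ ^ c := by gcongr
      have := mul_le_mul_of_nonneg_left this (by positivity : 0 ≤ 1 / (1 - θ))
      linarith
  | succ a iha =>
    intro c
    induction c with
    | zero =>
      simp only [lpp]
      rw [hstep (a + 1, 0) _ (hmeas _ _ _ (by simp))]
      refine (mul_le_mul_right (iha 0) _).trans ?_
      rw [← ENNReal.ofReal_mul (by positivity)]
      refine ENNReal.ofReal_le_ofReal ?_
      rw [pow_succ, pow_zero, mul_one, mul_one]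
      have : 1 / (1 - θ) * ρ ^ a ≤ ρ * ρ ^ a := by gcongr
      have := mul_le_mul_of_nonneg_left this (by positivity : 0 ≤ 1 / (1 - θ))
      linarith
    | succ c ihc =>
      simp only [lpp]
      rw [hstep (a + 1, c + 1) _ ((hmeas (a + 1, c + 1) a (c + 1) (by simp)).max
        (hmeas (a + 1, c + 1) (a + 1) c (by simp)))]
      have hmax : ∀ ω, ENNReal.ofReal (Real.exp (θ * max (lpp (fun i j => X i j ω) a (c + 1))
            (lpp (fun i j => X i j ω) (a + 1) c))) ≤
          ENNReal.ofReal (Real.exp (θ * lpp (fun i j => X i j ω) a (c + 1))) +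
          ENNReal.ofReal (Real.exp (θ * lpp (fun i j => X i j ω) (a + 1) c)) := by
        intro ω
        rcases max_choice (lpp (fun i j => X i j ω) a (c + 1))
          (lpp (fun i j => X i j ω) (a + 1) c) with e | e <;> rw [e]
        · exact le_self_add
        · exact le_add_self
      refine (mul_le_mul_right (lintegral_mono hmax) _).trans ?_
      rw [lintegral_add_left' (by
        have : Measurable fun ω => lpp (fun i j => X i j ω) a (c + 1) :=
          measurable_lpp fun i _ j _ => hXm i j
        exact (this.const_mul θ).exp.ennreal_ofReal.aemeasurable)]
      refine (mul_le_mul_right (add_le_add (iha (c + 1)) ihc) _).trans ?_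
      rw [← ENNReal.ofReal_add (by positivity) (by positivity),
        ← ENNReal.ofReal_mul (by positivity)]
      refine ENNReal.ofReal_le_ofReal (mul_le_mul_of_nonneg_left ?_ (by positivity))
      have e1 : 1 / (1 - θ) * (ρ ^ a * σ ^ (c + 1)) + 1 / (1 - θ) * (ρ ^ (a + 1) * σ ^ c) =
          (1 / ρ + 1 / σ) / (1 - θ) * (ρ ^ (a + 1) * σ ^ (c + 1)) := by
        field_simp
        ring
      rw [e1]
      refine mul_le_of_le_one_left (by positivity) ?_
      rw [div_le_one hθ']
      exact h

/-- Chernoff bound for the upper tail of last-passage times. -/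
theorem measure_le_lpp_le (hX : iIndepFun (fun s : ℕ × ℕ => X s.1 s.2) P)
    (hXm : ∀ i j, Measurable (X i j)) (hlaw : ∀ i j, P.map (X i j) = expMeasure 1)
    {θ ρ σ : ℝ} (hθ0 : 0 ≤ θ) (hθ : θ < 1) (hρ : 0 < ρ) (hσ : 0 < σ)
    (h : 1 / ρ + 1 / σ ≤ 1 - θ) (a c : ℕ) (x : ℝ) :
    P {ω | x ≤ lpp (fun i j => X i j ω) a c} ≤
      ENNReal.ofReal (Real.exp (-(θ * x)) * (1 / (1 - θ) * (ρ ^ a * σ ^ c))) := by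
  have hm : Measurable fun ω => lpp (fun i j => X i j ω) a c :=
    measurable_lpp fun i _ j _ => hXm i j
  calc P {ω | x ≤ lpp (fun i j => X i j ω) a c}
      ≤ P {ω | ENNReal.ofReal (Real.exp (θ * x)) ≤
          ENNReal.ofReal (Real.exp (θ * lpp (fun i j => X i j ω) a c))} := by
        refine measure_mono fun ω hω => ?_
        simp only [Set.mem_ofPred_eq] at hω ⊢
        exact ENNReal.ofReal_le_ofReal (Real.exp_le_exp.2 (by gcongr))
    _ ≤ (∫⁻ ω, ENNReal.ofReal (Real.exp (θ * lpp (fun i j => X i j ω) a c)) ∂P) /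
          ENNReal.ofReal (Real.exp (θ * x)) :=
        meas_ge_le_lintegral_div (hm.const_mul θ).exp.ennreal_ofReal.aemeasurable
          (by simp [Real.exp_pos]) ENNReal.ofReal_ne_top
    _ ≤ ENNReal.ofReal (1 / (1 - θ) * (ρ ^ a * σ ^ c)) / ENNReal.ofReal (Real.exp (θ * x)) := by
        gcongr
        exact lintegral_exp_lpp_le hX hXm hlaw hθ hρ hσ h a c
    _ = _ := by
        rw [← ENNReal.ofReal_div_of_pos (Real.exp_pos _), Real.exp_neg]
        congr 1
        rw [div_eq_inv_mul]

end Tails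

/-! ### Vertical starts towards nearly horizontal targets -/

/-- The parameters of the two Chernoff bounds: `c` separates the speed `1` of nearly horizontal
passage times from the speed `1 / α` of the stationary model, `η` serves for the lower tail of the
latter, and `θ`, `ρ`, `σ` for the upper tail of the former, along the direction `(A, 1)`. -/
theorem exists_chernoff_parameters {α : ℝ} (hα : 0 < α) (hα1 : α < 1) :
    ∃ (c η θ ρ σ : ℝ) (A : ℕ), 0 < c ∧ 0 < η ∧ Real.exp (η * c) * (α / (α + η)) < 1 ∧ 0 < θ ∧ θ < 1 ∧
      0 < ρ ∧ 0 < σ ∧ 1 / ρ + 1 / σ ≤ 1 - θ ∧ 1 ≤ A ∧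
      (Real.exp (-(θ * c)) * ρ) ^ A * σ < 1 := by
  obtain ⟨c, hc1, hc2⟩ := exists_between ((one_lt_div hα).2 hα1)
  have hαc : α * c < 1 := by rwa [lt_div_iff₀ hα, mul_comm] at hc2
  have hc0 : 0 < c := by linarith
  set η := (1 - α * c) / (2 * c) with hη
  have hηc : η * c = (1 - α * c) / 2 := by rw [hη]; field_simp
  have hη0 : 0 < η := div_pos (by linarith) (by linarith)
  have hlow : Real.exp (η * c) * (α / (α + η)) < 1 := by
    have h1 := Real.add_one_le_exp (-(η * c))
    have h2 : 0 < 1 - η * c := by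
      have : 0 < α * c := by positivity
      rw [hηc]; linarith
    have h3 : α < (α + η) * (1 - η * c) := by nlinarith [mul_pos hη0 (by linarith : 0 < 1 - α * c)]
    have h4 : Real.exp (η * c) * (1 - η * c) ≤ 1 := by
      calc Real.exp (η * c) * (1 - η * c) ≤ Real.exp (η * c) * Real.exp (-(η * c)) := by
            gcongr; linarith
        _ = 1 := by rw [← Real.exp_add]; simp
    rw [← mul_div_assoc, div_lt_one (by positivity)]
    calc Real.exp (η * c) * α < Real.exp (η * c) * ((α + η) * (1 - η * c)) := by gcongr
      _ = (α + η) * (Real.exp (η * c) * (1 - η * c)) := by ring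
      _ ≤ (α + η) * 1 := by gcongr
      _ = α + η := mul_one _
  set θ := (c - 1) / (2 * c) with hθ
  have hθc : θ * c = (c - 1) / 2 := by rw [hθ]; field_simp
  have hθ0 : 0 < θ := div_pos (by linarith) (by linarith)
  have hθ1 : θ < 1 := by rw [hθ, div_lt_one (by linarith)]; linarith
  have hgap : 1 / (1 - θ) < Real.exp (θ * c) := by
    refine lt_of_lt_of_le ?_ (Real.add_one_le_exp _)
    rw [div_lt_iff₀ (by linarith)]
    nlinarith [mul_pos hθ0 (by linarith : 0 < c - 1)]
  obtain ⟨ρ, hρ1, hρ2⟩ := exists_between hgap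
  have hρ0 : 0 < ρ := lt_trans (one_div_pos.2 (by linarith)) hρ1
  have hρ3 : 0 < 1 - θ - 1 / ρ := by
    have : 1 / ρ < 1 - θ := by rwa [one_div_lt hρ0 (by linarith)]
    linarith
  set σ := 1 / (1 - θ - 1 / ρ) with hσ
  have hσ0 : 0 < σ := one_div_pos.2 hρ3
  have hr : Real.exp (-(θ * c)) * ρ < 1 := by
    calc Real.exp (-(θ * c)) * ρ < Real.exp (-(θ * c)) * Real.exp (θ * c) := by gcongr
      _ = 1 := by rw [← Real.exp_add]; simp
  obtain ⟨A, hA⟩ := exists_pow_lt_of_lt_one (one_div_pos.2 hσ0) hr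
  refine ⟨c, η, θ, ρ, σ, A + 1, hc0, hη0, hlow, hθ0, hθ1, hρ0, hσ0, ?_, by omega, ?_⟩
  · rw [hσ, one_div_one_div]; linarith
  · rw [lt_div_iff₀ hσ0] at hA
    refine lt_of_le_of_lt ?_ hA
    exact mul_le_mul_of_nonneg_right (pow_le_pow_of_le_one (by positivity) hr.le (by omega)) hσ0.le

theorem iIndepFun_reflect {Ω : Type*} [MeasurableSpace Ω] {P : Measure Ω} {w : ℤ → ℤ → Ω → ℝ}
    (hw : iIndepFun (fun s : ℤ × ℤ => w s.1 s.2) P) (p q : ℤ) :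
    iIndepFun (fun s : ℕ × ℕ => w (p - s.1) (q - s.2)) P := by
  refine hw.precomp (g := fun s : ℕ × ℕ => ((p - s.1, q - s.2) : ℤ × ℤ)) ?_
  rintro ⟨a, b⟩ ⟨c, d⟩ h
  simp only [Prod.mk.injEq] at h ⊢
  omega

section Targets

variable {Ω : Type*} [MeasurableSpace Ω] {P : Measure Ω} [IsProbabilityMeasure P]
  {w : ℤ → ℤ → Ω → ℝ}

/-- The event that the stationary field rooted at `(A * N + 2, N + 2)` starts vertically at the
origin has probability at most `β`; off this event, a vertical start towards `(A * j + 1, j + 1)`,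
for any `j ≤ N`, is exponentially unlikely in `j`. -/
theorem exists_geometric_bound (hw : iIndepFun (fun s : ℤ × ℤ => w s.1 s.2) P)
    (hwm : ∀ p q, Measurable (w p q)) (hlaw : ∀ p q, P.map (w p q) = expMeasure 1)
    {α β : ℝ} (hα : 0 < α) (hβ : 0 < β) (hαβ : α + β = 1) :
    ∃ (A : ℕ) (C q : ℝ), 0 ≤ q ∧ q < 1 ∧ ∀ N : ℕ, ∃ B : Set Ω,
      P B ≤ ENNReal.ofReal β ∧ ∀ j ≤ N,
        P ({ω | StartsVertically (fun p q => w p q ω) (A * j) j} \ B) ≤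
          ENNReal.ofReal (C * q ^ j) := by
  obtain ⟨c, η, θ, ρ, σ, A, hc, hη, hlow, hθ0, hθ1, hρ, hσ, hρσ, hA, hup⟩ :=
    exists_chernoff_parameters hα (by linarith)
  set q₁ := Real.exp (η * c) * (α / (α + η)) with hq₁
  set q₂ := (Real.exp (-(θ * c)) * ρ) ^ A * σ with hq₂
  have hq₁0 : 0 ≤ q₁ := by positivity
  have hq₂0 : 0 ≤ q₂ := by positivity
  have hθ2 : 0 < 1 - θ := by linarith
  set K := 1 / (1 - θ) * (ρ * σ) with hK
  have hK0 : 0 ≤ K := by positivity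
  refine ⟨A, 1 + K, max q₁ q₂, le_max_of_le_left hq₁0, max_lt hlow hup,
    fun N => ?_⟩
  set M : ℤ := A * N + 2 with hM
  set L : ℤ := N + 2 with hL
  let X : ℕ → ℕ → Ω → ℝ := fun i j => w (M - i) (L - j)
  have hX : iIndepFun (fun s : ℕ × ℕ => X s.1 s.2) P := iIndepFun_reflect hw M L
  have hXm : ∀ i j, Measurable (X i j) := fun i j => hwm _ _
  have hXlaw : ∀ i j, P.map (X i j) = expMeasure 1 := fun i j => hlaw _ _
  let Z : Ω → ℕ → ℕ → ℝ := fun ω => stationary α β (fun i j => X i j ω)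
  refine ⟨{ω | Z ω (A * N + 1) (N + 1 + 1) ≤ Z ω (A * N + 1 + 1) (N + 1)},
    measure_stationary_le hα hβ hαβ hX hXm hXlaw (A * N + 1) (N + 1), fun j hj => ?_⟩
  have hAj : A * j ≤ A * N := Nat.mul_le_mul_left A hj
  obtain ⟨s, hs⟩ := Nat.exists_eq_add_of_le hAj
  obtain ⟨t, ht⟩ := Nat.exists_eq_add_of_le hj
  have hpos : ∀ᵐ ω ∂P, ∀ p q, 0 ≤ w p q ω := by
    rw [ae_all_iff]; intro p
    rw [ae_all_iff]; intro q
    have h := ae_pos_expMeasure one_pos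
    rw [← hlaw p q] at h
    filter_upwards [ae_of_ae_map (hwm p q).aemeasurable h] with ω hω using hω.le
  let U : Set Ω := {ω | Z ω (s + (A * j + 2)) (N + 2) - Z ω s (N + 2) ≤ c * (A * j)}
  let V : Set Ω := {ω | c * (A * j) ≤
    lpp (fun a b => w (((A * j : ℕ) : ℤ) + 1 - a) ((j : ℤ) + 1 - b) ω) (A * j + 1) (j + 1)}
  have hU : P U ≤ ENNReal.ofReal (q₁ ^ j) := by
    refine (measure_stationary_increment_le hα hβ hαβ hX hXm hXlaw s (A * j + 2) (N + 2) hη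
      (c * (A * j))).trans (ENNReal.ofReal_le_ofReal ?_)
    have hfrac : α / (α + η) ≤ 1 := by rw [div_le_one (by positivity)]; linarith
    have hfrac0 : 0 ≤ α / (α + η) := by positivity
    calc Real.exp (η * (c * (A * j))) * (α / (α + η)) ^ (A * j + 2)
        ≤ Real.exp (η * (c * (A * j))) * (α / (α + η)) ^ (A * j) := by
          gcongr ?_ * ?_
          exact pow_le_pow_of_le_one hfrac0 hfrac (by omega)
      _ = q₁ ^ (A * j) := by
          rw [hq₁, mul_pow, ← Real.exp_nat_mul]; push_cast; ring_nf
      _ ≤ q₁ ^ j := pow_le_pow_of_le_one hq₁0 hlow.le (Nat.le_mul_of_pos_left j hA)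
  have hV : P V ≤ ENNReal.ofReal (K * q₂ ^ j) := by
    refine (measure_le_lpp_le (iIndepFun_reflect hw _ _) (fun _ _ => hwm _ _)
      (fun _ _ => hlaw _ _) hθ0.le hθ1 hρ hσ hρσ (A * j + 1) (j + 1) (c * (A * j))).trans
      (ENNReal.ofReal_le_ofReal (le_of_eq ?_))
    have : Real.exp (-(θ * (c * (A * j)))) = Real.exp (-(θ * c)) ^ (A * j) := by
      rw [← Real.exp_nat_mul]; push_cast; ring_nf
    rw [this, hq₂, hK, mul_pow, ← pow_mul, mul_pow]
    ring
  have hsub : ∀ᵐ ω ∂P, ω ∈ {ω | StartsVertically (fun p q => w p q ω) (A * j) j} \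
      {ω | Z ω (A * N + 1) (N + 1 + 1) ≤ Z ω (A * N + 1 + 1) (N + 1)} → ω ∈ U ∪ V := by
    filter_upwards [hpos] with ω hω
    rintro ⟨hE, hB⟩
    have hB' : Z ω (A * N + 1 + 1) (N + 1) < Z ω (A * N + 1) (N + 1 + 1) := not_le.1 hB
    have key := field_le_lpp_add (w := fun p q => w p q ω) hω (Z := Z ω) (m := A * j) (n := j)
      (s := s) (t := t) (M := M) (L := L) (by rw [hM]; exact_mod_cast congrArg (· + 2) hs)
      (by rw [hL]; exact_mod_cast congrArg (· + 2) ht)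
      (isPassageField_stationary _ _ _) (monotone_stationary hβ (fun _ _ => hω _ _) s) hE
      (by
        have e1 : s + A * j = A * N := by omega
        have e2 : t + j = N := by omega
        rw [e1, e2]; exact hB')
    have e2 : t + j = N := by omega
    rw [e2, add_assoc s] at key
    by_contra hUV
    rw [Set.mem_union, not_or] at hUV
    have h1 : c * (A * j) < Z ω (s + (A * j + 2)) (N + 2) - Z ω s (N + 2) := not_le.1 hUV.1
    have h2 : lpp (reflect (fun p q => w p q ω) ((A * j : ℕ) + 1) (j + 1)) (A * j + 1) (j + 1) <
      c * (A * j) := not_le.1 hUV.2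
    linarith
  calc P ({ω | StartsVertically (fun p q => w p q ω) (A * j) j} \
        {ω | Z ω (A * N + 1) (N + 1 + 1) ≤ Z ω (A * N + 1 + 1) (N + 1)}) ≤ P (U ∪ V) :=
        measure_mono_ae hsub
    _ ≤ P U + P V := measure_union_le _ _
    _ ≤ ENNReal.ofReal (q₁ ^ j) + ENNReal.ofReal (K * q₂ ^ j) := add_le_add hU hV
    _ = ENNReal.ofReal (q₁ ^ j + K * q₂ ^ j) :=
        (ENNReal.ofReal_add (by positivity) (by positivity)).symm
    _ ≤ ENNReal.ofReal ((1 + K) * max q₁ q₂ ^ j) := by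
        refine ENNReal.ofReal_le_ofReal ?_
        rw [add_mul, one_mul]
        gcongr
        · exact le_max_left _ _
        · exact le_max_right _ _

/-- Almost surely, for some slope, no maximal path from the origin towards a far target of this
slope can start vertically. -/
theorem ae_exists_not_startsVertically (hw : iIndepFun (fun s : ℤ × ℤ => w s.1 s.2) P)
    (hwm : ∀ p q, Measurable (w p q)) (hlaw : ∀ p q, P.map (w p q) = expMeasure 1) :
    ∀ᵐ ω ∂P, ∃ A N : ℕ, ∀ j ≥ N, ¬ StartsVertically (fun p q => w p q ω) (A * j) j := by
  rw [ae_iff]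
  refine le_antisymm ?_ bot_le
  refine ENNReal.le_of_forall_pos_le_add fun ε hε _ => ?_
  rw [zero_add]
  set β : ℝ := min ε (1 / 2) with hβdef
  have hβ : 0 < β := lt_min (by exact_mod_cast hε) (by norm_num)
  have hβ1 : β ≤ 1 / 2 := min_le_right _ _
  obtain ⟨A, C, q, hq0, hq1, hB⟩ := exists_geometric_bound hw hwm hlaw
    (α := 1 - β) (by linarith) hβ (by ring)
  let E : ℕ → Set Ω := fun j => {ω | StartsVertically (fun p q => w p q ω) (A * j) j}
  let f : ℕ → ℝ≥0∞ := fun j => ENNReal.ofReal (C * q ^ j)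
  have hf : ∑' j, f j ≠ ⊤ :=
    ((summable_geometric_of_lt_one hq0 hq1).mul_left C).tsum_ofReal_ne_top
  have hfinite : ∀ N N', P (⋃ k ∈ Finset.range N', E (k + N)) ≤
      ENNReal.ofReal β + ∑' k, f (k + N) := by
    intro N N'
    obtain ⟨B, hPB, hBj⟩ := hB (N' + N)
    calc P (⋃ k ∈ Finset.range N', E (k + N))
        ≤ P (B ∪ ⋃ k ∈ Finset.range N', (E (k + N) \ B)) := by
          refine measure_mono fun ω hω => ?_
          simp only [Set.mem_iUnion, Set.mem_union, Set.mem_sdiff, exists_prop] at hω ⊢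
          obtain ⟨k, hk, hk'⟩ := hω
          by_cases hωB : ω ∈ B
          · exact Or.inl hωB
          · exact Or.inr ⟨k, hk, hk', hωB⟩
      _ ≤ P B + ∑ k ∈ Finset.range N', P (E (k + N) \ B) :=
          (measure_union_le _ _).trans (by gcongr; exact measure_biUnion_finset_le _ _)
      _ ≤ ENNReal.ofReal β + ∑ k ∈ Finset.range N', f (k + N) := by
          refine add_le_add hPB (Finset.sum_le_sum fun k hk => hBj _ ?_)
          have := Finset.mem_range.1 hk
          omega
      _ ≤ ENNReal.ofReal β + ∑' k, f (k + N) := by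
          gcongr
          exact ENNReal.sum_le_tsum _
  have htail : ∀ N, P (⋃ k, E (k + N)) ≤ ENNReal.ofReal β + ∑' k, f (k + N) := by
    intro N
    have hU : ⋃ k, E (k + N) = ⋃ N', ⋃ k ∈ Finset.range N', E (k + N) := by
      ext ω
      simp only [Set.mem_iUnion, Finset.mem_range, exists_prop]
      exact ⟨fun ⟨k, hk⟩ => ⟨k + 1, k, by omega, hk⟩, fun ⟨_, k, _, hk⟩ => ⟨k, hk⟩⟩
    have hmono : Monotone fun N' => ⋃ k ∈ Finset.range N', E (k + N) := fun a b hab =>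
      Set.biUnion_subset_biUnion_left fun k hk => Finset.range_mono hab hk
    rw [hU, hmono.measure_iUnion]
    exact iSup_le (hfinite N)
  have hlim : Tendsto (fun N => ENNReal.ofReal β + ∑' k, f (k + N)) atTop
      (nhds (ENNReal.ofReal β + 0)) := by
    exact tendsto_const_nhds.add (ENNReal.tendsto_sum_nat_add f hf)
  have hβε : ENNReal.ofReal β ≤ ε := by
    rw [← ENNReal.ofReal_coe_nnreal]
    exact ENNReal.ofReal_le_ofReal (min_le_left _ _)
  rw [add_zero] at hlim
  refine (ge_of_tendsto' hlim fun N => le_trans (measure_mono fun ω hω => ?_) (htail N)).trans hβε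
  simp only [Set.mem_ofPred_eq, not_exists, not_forall, not_not] at hω
  obtain ⟨j, hj, hjE⟩ := hω A N
  exact Set.mem_iUnion.2 ⟨j - N, by rw [Nat.sub_add_cancel hj]; exact hjE⟩

end Targets

/-! ### Up-right paths and last-passage times -/

/-- The site `x + p e_i + q e_{3-i}`, so that direction `i` is the horizontal one. -/
def site (i : Fin 2) (x : Site) (p q : ℤ) : Site := x + p • e i + q • e i.rev

theorem rev_ne (i : Fin 2) : i.rev ≠ i := by fin_cases i <;> simp

theorem eq_or_eq_rev (i j : Fin 2) : j = i ∨ j = i.rev := by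
  fin_cases i <;> fin_cases j <;> simp

theorem site_apply (i : Fin 2) (x : Site) (p q : ℤ) : site i x p q i = x i + p := by
  simp [site, e, (rev_ne i).symm]

theorem site_apply_rev (i : Fin 2) (x : Site) (p q : ℤ) :
    site i x p q i.rev = x i.rev + q := by
  simp [site, e, rev_ne i]

theorem site_injective (i : Fin 2) (x : Site) :
    Function.Injective fun s : ℤ × ℤ => site i x s.1 s.2 := by
  rintro ⟨p, q⟩ ⟨p', q'⟩ h
  have h1 := congrFun h i
  have h2 := congrFun h i.rev
  simp only [site_apply, site_apply_rev] at h1 h2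
  simp only [Prod.mk.injEq]
  omega

theorem site_add_e (i : Fin 2) (x : Site) (p q : ℤ) : site i x p q + e i = site i x (p + 1) q := by
  simp only [site, add_smul, one_smul]; abel

theorem site_add_e_rev (i : Fin 2) (x : Site) (p q : ℤ) :
    site i x p q + e i.rev = site i x p (q + 1) := by
  simp only [site, add_smul, one_smul]; abel

theorem site_zero (i : Fin 2) (x : Site) : site i x 0 0 = x := by simp [site]

theorem le_of_step {y z : Site} {j : Fin 2} (h : z - y = e j) : y ≤ z := by
  rw [sub_eq_iff_eq_add.1 h]
  intro l
  simp only [Pi.add_apply, e]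
  have : (0 : ℤ) ≤ (Pi.single j 1 : Site) l := by
    rcases eq_or_ne l j with rfl | h <;> simp [*]
  omega

theorem IsUpRightPath.tail {x y : Site} {n : ℕ} {π : ℕ → Site} (h : IsUpRightPath x y (n + 1) π) :
    IsUpRightPath (π 1) y n fun k => π (k + 1) :=
  ⟨rfl, h.finish, fun k hk => h.step (k + 1) (by omega)⟩

theorem IsUpRightPath.le : ∀ {n : ℕ} {x y : Site} {π : ℕ → Site}, IsUpRightPath x y n π → x ≤ y
  | 0, _, _, _, h => (h.start.symm.trans h.finish).le
  | n + 1, _, _, _, h => by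
    obtain ⟨j, hj⟩ := h.step 0 (by omega)
    rw [← h.start]
    exact (le_of_step hj).trans h.tail.le

theorem IsUpRightPath.cons {x x' y : Site} {n : ℕ} {π : ℕ → Site} (h : IsUpRightPath x' y n π)
    {j : Fin 2} (hj : x' - x = e j) :
    IsUpRightPath x y (n + 1) (fun k => Nat.casesOn k x π) := by
  refine ⟨rfl, h.finish, fun k hk => ?_⟩
  cases k with
  | zero => exact ⟨j, by simpa [h.start] using hj⟩
  | succ k => exact h.step k (by omega)

theorem passageTime_succ (w : Site → ℝ) (n : ℕ) (π : ℕ → Site) :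
    passageTime w (n + 1) π = w (π 0) + passageTime w n fun k => π (k + 1) := by
  rw [passageTime, Finset.sum_range_succ', add_comm, passageTime]

theorem add_lpp_le_left (u : ℕ → ℕ → ℝ) (a c : ℕ) :
    u (a + 1) c + lpp u a c ≤ lpp u (a + 1) c := by
  cases c with
  | zero => simp [lpp]
  | succ c => rw [isPassageField_lpp]; gcongr; exact le_max_left _ _

theorem add_lpp_le_right (u : ℕ → ℕ → ℝ) (a c : ℕ) :
    u a (c + 1) + lpp u a c ≤ lpp u a (c + 1) := by
  cases a with
  | zero => simp [lpp]
  | succ a => rw [isPassageField_lpp]; gcongr; exact le_max_right _ _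

/-- Together with `exists_passageTime_eq_lpp`: the recursion `lpp` computes the maximal passage time
over up-right paths. -/
theorem passageTime_le_lpp (w : Site → ℝ) (i : Fin 2) (x : Site) (p q : ℤ) :
    ∀ (n a c : ℕ) (π : ℕ → Site),
      IsUpRightPath (site i x (p - a) (q - c)) (site i x p q) n π →
      passageTime w n π ≤ lpp (reflect (fun p q => w (site i x p q)) p q) a c := by
  intro n
  induction n with
  | zero =>
    intro a c π h
    have h1 := site_injective i x (a₁ := (p - a, q - c)) (a₂ := (p, q))
      (h.start.symm.trans h.finish)
    simp only [Prod.mk.injEq] at h1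
    obtain rfl : a = 0 := by omega
    obtain rfl : c = 0 := by omega
    simp [passageTime, lpp, reflect, h.start]
  | succ n ih =>
    intro a c π h
    rw [passageTime_succ, h.start]
    obtain ⟨j, hj⟩ := h.step 0 (by omega)
    rw [sub_eq_iff_eq_add', h.start] at hj
    have htail := h.tail
    have hle := htail.le
    rcases eq_or_eq_rev i j with rfl | rfl
    · rw [site_add_e] at hj
      rw [zero_add] at hj
      rw [hj] at hle htail
      have h1 : x j + (p - a + 1) ≤ x j + p := by
        simpa only [site_apply] using hle j
      obtain ⟨a', rfl⟩ : ∃ a', a = a' + 1 := ⟨a - 1, by omega⟩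
      have h2 : p - ((a' + 1 : ℕ) : ℤ) + 1 = p - a' := by push_cast; ring
      rw [h2] at htail
      exact (add_le_add_right (ih a' c _ htail) _).trans
        (add_lpp_le_left (reflect (fun p q => w (site j x p q)) p q) a' c)
    · rw [site_add_e_rev] at hj
      rw [zero_add] at hj
      rw [hj] at hle htail
      have h1 : x i.rev + (q - c + 1) ≤ x i.rev + q := by
        simpa only [site_apply_rev] using hle i.rev
      obtain ⟨c', rfl⟩ : ∃ c', c = c' + 1 := ⟨c - 1, by omega⟩
      have h2 : q - ((c' + 1 : ℕ) : ℤ) + 1 = q - c' := by push_cast; ring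
      rw [h2] at htail
      exact (add_le_add_right (ih a c' _ htail) _).trans
        (add_lpp_le_right (reflect (fun p q => w (site i x p q)) p q) a c')

theorem exists_passageTime_eq_lpp (w : Site → ℝ) (i : Fin 2) (x : Site) (p q : ℤ) :
    ∀ a c : ℕ, ∃ π, IsUpRightPath (site i x (p - a) (q - c)) (site i x p q) (a + c) π ∧
      passageTime w (a + c) π = lpp (reflect (fun p q => w (site i x p q)) p q) a c := by
  have hleft : ∀ a c : ℕ, (∃ π, IsUpRightPath (site i x (p - a) (q - c)) (site i x p q) (a + c) π ∧
      passageTime w (a + c) π = lpp (reflect (fun p q => w (site i x p q)) p q) a c) →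
      ∃ π, IsUpRightPath (site i x (p - (a + 1 : ℕ)) (q - c)) (site i x p q) (a + 1 + c) π ∧
      passageTime w (a + 1 + c) π = reflect (fun p q => w (site i x p q)) p q (a + 1) c +
        lpp (reflect (fun p q => w (site i x p q)) p q) a c := by
    rintro a c ⟨π, hπ, hval⟩
    have hstep : site i x (p - a) (q - c) - site i x (p - (a + 1 : ℕ)) (q - c) = e i := by
      rw [sub_eq_iff_eq_add', site_add_e]; congr 1; push_cast; ring
    rw [Nat.add_right_comm]
    refine ⟨_, hπ.cons hstep, ?_⟩
    rw [passageTime_succ]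
    exact congrArg₂ (· + ·) rfl hval
  have hright : ∀ a c : ℕ,
      (∃ π, IsUpRightPath (site i x (p - a) (q - c)) (site i x p q) (a + c) π ∧
      passageTime w (a + c) π = lpp (reflect (fun p q => w (site i x p q)) p q) a c) →
      ∃ π, IsUpRightPath (site i x (p - a) (q - (c + 1 : ℕ))) (site i x p q) (a + (c + 1)) π ∧
      passageTime w (a + (c + 1)) π = reflect (fun p q => w (site i x p q)) p q a (c + 1) +
        lpp (reflect (fun p q => w (site i x p q)) p q) a c := by
    rintro a c ⟨π, hπ, hval⟩
    have hstep : site i x (p - a) (q - c) - site i x (p - a) (q - (c + 1 : ℕ)) = e i.rev := by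
      rw [sub_eq_iff_eq_add', site_add_e_rev]; congr 1; push_cast; ring
    refine ⟨_, hπ.cons hstep, ?_⟩
    rw [← add_assoc, passageTime_succ]
    exact congrArg₂ (· + ·) rfl hval
  intro a
  induction a with
  | zero =>
    intro c
    induction c with
    | zero =>
      exact ⟨fun _ => site i x p q, ⟨by simp, rfl, by simp⟩, by simp [passageTime, lpp, reflect]⟩
    | succ c ih => simpa only [lpp] using hright 0 c ih
  | succ a iha =>
    intro c
    induction c with
    | zero => simpa only [lpp] using hleft a 0 (iha 0)
    | succ c ihc =>
      simp only [lpp]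
      rcases max_choice (lpp (reflect (fun p q => w (site i x p q)) p q) a (c + 1))
        (lpp (reflect (fun p q => w (site i x p q)) p q) (a + 1) c) with h | h <;> rw [h]
      · exact hleft a (c + 1) (iha (c + 1))
      · exact hright (a + 1) c ihc

theorem exists_eq_site {γ : ℕ → Site} (hγ : ∀ k, ∃ j : Fin 2, γ (k + 1) - γ k = e j) (i : Fin 2)
    (k : ℕ) : ∃ a c : ℕ, a + c = k ∧ γ k = site i (γ 0) a c := by
  induction k with
  | zero => exact ⟨0, 0, rfl, by simp [site_zero]⟩
  | succ k ih =>
    obtain ⟨a, c, hk, h⟩ := ih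
    obtain ⟨j, hj⟩ := hγ k
    rw [sub_eq_iff_eq_add', h] at hj
    rcases eq_or_eq_rev i j with rfl | rfl
    · exact ⟨a + 1, c, by omega, by rw [hj, site_add_e]; push_cast; rfl⟩
    · exact ⟨a, c + 1, by omega, by rw [hj, site_add_e_rev]; push_cast; rfl⟩

/-- A semi-infinite geodesic with first step `e_{3-i}` witnesses a vertical start towards each of its
later points. -/
theorem IsSemiInfiniteGeodesic.startsVertically {w : Site → ℝ} {γ : ℕ → Site}
    (hγ : IsSemiInfiniteGeodesic w γ) {i : Fin 2} (h1 : γ 1 = γ 0 + e i.rev) {m n : ℕ}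
    (h2 : γ (m + n + 2) = site i (γ 0) (m + 1) (n + 1)) :
    StartsVertically (fun p q => w (site i (γ 0) p q)) m n := by
  set x := γ 0 with hx
  obtain ⟨hpath, hmax⟩ := hγ.segment 0 (m + n + 2)
  simp only [zero_add] at hpath hmax
  rw [h2, ← hx] at hpath hmax
  obtain ⟨π, hπ, hval⟩ := exists_passageTime_eq_lpp w i x (m + 1) (n + 1) m (n + 1)
  have e1 : ((m : ℤ) + 1 - m) = 1 := by ring
  have e2 : ((n : ℤ) + 1 - (n + 1 : ℕ)) = 0 := by push_cast; ring
  rw [e1, e2] at hπ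
  have hstep : site i x 1 0 - x = e i := by
    have := site_add_e i x 0 0
    rw [site_zero, zero_add] at this
    rw [← this]; abel
  have h3 := hmax _ (hπ.cons hstep)
  rw [show m + n + 2 = m + (n + 1) + 1 by ring, passageTime_succ, passageTime_succ] at h3
  have h4 : passageTime w (m + (n + 1)) (fun k => γ (k + 1)) ≤
      lpp (reflect (fun p q => w (site i x p q)) (m + 1) (n + 1)) (m + 1) n := by
    refine passageTime_le_lpp w i x (m + 1) (n + 1) _ (m + 1) n _ ?_
    have h5 := hpath.tail
    have e3 : ((m : ℤ) + 1 - (m + 1 : ℕ)) = 0 := by push_cast; ring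
    have e4 : ((n : ℤ) + 1 - n) = 1 := by ring
    have h6 := site_add_e_rev i x 0 0
    rw [site_zero, zero_add] at h6
    rw [e3, e4, ← h6, ← h1]
    exact h5
  change w x + passageTime w (m + (n + 1)) π ≤ _ at h3
  rw [hval, ← hx] at h3
  exact (add_le_add_iff_left _).1 (h3.trans (add_le_add_right h4 _))

theorem lpp_zero_right (u : ℕ → ℕ → ℝ) (n : ℕ) :
    lpp u n 0 = ∑ k ∈ Finset.range (n + 1), u k 0 := by
  induction n with
  | zero => simp [lpp]
  | succ n ih => rw [lpp, ih, Finset.sum_range_succ _ (n + 1), add_comm]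

/-- A straight line in a coordinate direction is a semi-infinite geodesic, its segments being the
only up-right paths between their endpoints. -/
theorem isSemiInfiniteGeodesic_line (w : Site → ℝ) (i : Fin 2) (x : Site) :
    IsSemiInfiniteGeodesic w fun k => x + k • e i := by
  have hstep : ∀ k : ℕ, (x + (k + 1) • e i) - (x + k • e i) = e i := fun k => by
    rw [add_smul, one_smul]; abel
  refine ⟨fun k => ⟨i, hstep k⟩, fun m n => ⟨⟨rfl, rfl, fun k _ => ⟨i, hstep (m + k)⟩⟩, ?_⟩⟩
  intro π hπ
  have hsite : ∀ k : ℕ, x + k • e i = site i x k 0 := fun k => by simp [site]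
  rw [hsite, hsite] at hπ
  have h1 := passageTime_le_lpp w i x (m + n : ℕ) 0 n n 0 π (by
    have : ((m + n : ℕ) : ℤ) - n = m := by push_cast; ring
    simpa [this] using hπ)
  refine h1.trans (le_of_eq ?_)
  rw [lpp_zero_right, passageTime, ← Finset.sum_range_reflect]
  refine Finset.sum_congr rfl fun k hk => ?_
  have hk' := Finset.mem_range.1 hk
  rw [hsite, reflect]
  congr 2
  omega

/-! ### Semi-infinite geodesics in the coordinate directions -/

/-- A semi-infinite geodesic whose first step is `e_{3-i}`, but whose direction is `e_i` along a
subsequence, starts vertically towards targets on every line `q = p / A`. -/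
theorem IsSemiInfiniteGeodesic.exists_startsVertically {w : Site → ℝ} {γ : ℕ → Site}
    (hγ : IsSemiInfiniteGeodesic w γ) {i : Fin 2} (h1 : γ 1 = γ 0 + e i.rev)
    (h0 : 0 ≤ γ 0 i.rev)
    (hfreq : ∀ δ > (0 : ℝ), ∃ᶠ k : ℕ in atTop, (γ k i.rev : ℝ) < δ * k) (A N : ℕ) :
    ∃ j ≥ N, StartsVertically (fun p q => w (site i (γ 0) p q)) (A * j) j := by
  have hδ : (0 : ℝ) < 1 / (A + 2) := by positivity
  obtain ⟨k, hk, hlt⟩ := (hfreq _ hδ).forall_exists_of_atTop (2 * (A * N) + 3)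
  rw [div_mul_eq_mul_div, one_mul, lt_div_iff₀ (by positivity)] at hlt
  have hlt' : γ k i.rev * (A + 2) < k := by exact_mod_cast hlt
  obtain ⟨a, c, hac, hkc⟩ := exists_eq_site (γ := fun l => γ (l + 1)) (fun l => hγ.step (l + 1)) i
    (k - 1)
  have hk1 : k - 1 + 1 = k := by omega
  simp only [hk1, zero_add] at hkc
  have hkc' : γ k = site i (γ 0) a (c + 1) := by
    rw [hkc, h1]; simp only [site, add_smul, one_smul]; abel
  rw [hkc', site_apply_rev] at hlt'
  have hA : (0 : ℤ) ≤ A := by positivity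
  have hc : ((c : ℤ) + 1) * (A + 2) < k := by nlinarith
  have hc' : (c + 1) * (A + 2) < k := by exact_mod_cast hc
  have hka : k = a + c + 1 := by omega
  have ha1 : A * c + 1 ≤ a := by nlinarith
  have ha2 : A * N + 1 ≤ a := by nlinarith
  obtain ⟨m, rfl⟩ : ∃ m, a = m + 1 := ⟨a - 1, by omega⟩
  have hS := hγ.startsVertically (m := m) (n := c) h1
    (by rw [show m + c + 2 = k by omega, hkc']; push_cast; rfl)
  refine ⟨max c N, le_max_right _ _, hS.mono ?_ (le_max_left _ _)⟩
  rcases max_choice c N with h | h <;> rw [h] <;> omega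

end CornerGrowth

open CornerGrowth in
theorem theorem2p2 {Ω : Type*} [MeasurableSpace Ω] (P : Measure Ω) [IsProbabilityMeasure P]
    (ω : CornerGrowth.Site → Ω → ℝ)
    (hindep : iIndepFun ω P)
    (hexp : ∀ z : CornerGrowth.Site, HasLaw (ω z) (expMeasure 1) P) :
    ∀ᵐ a ∂P, ∀ i : Fin 2, ∀ x : CornerGrowth.Site, 0 ≤ x → ∀ γ : ℕ → CornerGrowth.Site,
      (CornerGrowth.IsSemiInfiniteGeodesic (fun z => ω z a) γ ∧ γ 0 = x ∧
          liminf (fun k : ℕ => (k : ℝ)⁻¹ * (γ k i.rev : ℝ)) atTop = 0) ↔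
        γ = fun k : ℕ => x + k • CornerGrowth.e i := by
  -- measurable versions of the weights
  let W : Site → Ω → ℝ := fun z => (hexp z).aemeasurable.mk (ω z)
  have hWm : ∀ z, Measurable (W z) := fun z => (hexp z).aemeasurable.measurable_mk
  have hWae : ∀ z, ω z =ᵐ[P] W z := fun z => (hexp z).aemeasurable.ae_eq_mk
  have hWind : iIndepFun W P := hindep.congr hWae
  have hWlaw : ∀ z, P.map (W z) = expMeasure 1 := fun z =>
    (Measure.map_congr (hWae z)).symm.trans (hexp z).map_eq
  have hmain : ∀ᵐ a ∂P, ∀ (i : Fin 2) (x : Site), ∃ A N : ℕ,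
      ∀ j ≥ N, ¬ StartsVertically (fun p q => W (site i x p q) a) (A * j) j := by
    rw [ae_all_iff]; intro i
    rw [ae_all_iff]; intro x
    exact ae_exists_not_startsVertically (w := fun p q => W (site i x p q))
      (hWind.precomp (site_injective i x)) (fun _ _ => hWm _) (fun _ _ => hWlaw _)
  filter_upwards [hmain, ae_all_iff.2 hWae] with a ha hWa i x hx γ
  have hw : (fun z => ω z a) = fun z => W z a := funext hWa
  rw [hw]
  constructor
  · rintro ⟨hγ, h0, hlim⟩
    have hfreq : ∀ δ > (0 : ℝ), ∃ᶠ k : ℕ in atTop, (γ k i.rev : ℝ) < δ * k := by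
      intro δ hδ
      have hbdd : IsBoundedUnder (· ≤ ·) atTop
          fun k : ℕ => (k : ℝ)⁻¹ * (γ k i.rev : ℝ) := by
        refine ⟨x i.rev + 1, ?_⟩
        rw [eventually_map]
        filter_upwards [eventually_ge_atTop 1] with k hk
        obtain ⟨b, c, hbc, hkc⟩ := exists_eq_site hγ.step i k
        rw [hkc, site_apply_rev, h0]
        have hk0 : (1 : ℝ) ≤ k := by exact_mod_cast hk
        have hc : (c : ℝ) ≤ k := by exact_mod_cast (by omega : c ≤ k)
        have hx0 : (0 : ℝ) ≤ x i.rev := by exact_mod_cast hx i.rev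
        rw [inv_mul_le_iff₀ (by linarith)]
        push_cast
        nlinarith
      have h1 := frequently_lt_of_liminf_lt hbdd.isCoboundedUnder_ge
        (show liminf (fun k : ℕ => (k : ℝ)⁻¹ * (γ k i.rev : ℝ)) atTop < δ by rw [hlim]; exact hδ)
      refine (h1.and_eventually (eventually_ge_atTop 1)).mono fun k hk => ?_
      have hk0 : (0 : ℝ) < k := by exact_mod_cast hk.2
      have := hk.1
      rwa [inv_mul_lt_iff₀ hk0, mul_comm] at this
    funext k
    induction k with
    | zero => simp [h0]
    | succ k ih =>
      obtain ⟨j, hj⟩ := hγ.step k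
      rcases eq_or_eq_rev i j with rfl | rfl
      · rw [sub_eq_iff_eq_add'] at hj
        rw [hj, ih, add_smul, one_smul, add_assoc]
      -- a step in the other direction at `γ k` contradicts the choice of slope at that site
      exfalso
      obtain ⟨A, N, hAN⟩ := ha i (γ k)
      have hshift : IsSemiInfiniteGeodesic (fun z => W z a) fun l => γ (k + l) :=
        ⟨fun l => hγ.step (k + l), fun m n => by simpa only [add_assoc] using hγ.segment (k + m) n⟩
      obtain ⟨j, hj1, hj2⟩ := hshift.exists_startsVertically (i := i)
        (by rw [add_zero, ← sub_eq_iff_eq_add']; exact hj)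
        (by
          rw [add_zero, ih]
          simp [e, rev_ne i]
          exact hx i.rev)
        (fun δ hδ => by
          rw [frequently_atTop]
          intro l
          obtain ⟨K, hK, hlt⟩ := (hfreq (δ / 2) (by linarith)).forall_exists_of_atTop (l + 2 * k)
          refine ⟨K - k, by omega, ?_⟩
          rw [Nat.add_sub_cancel' (by omega), Nat.cast_sub (by omega)]
          have : (2 * k : ℝ) ≤ K := by exact_mod_cast (by omega : 2 * k ≤ K)
          nlinarith) A N
      exact hAN j hj1 hj2
  · rintro rfl
    refine ⟨isSemiInfiniteGeodesic_line _ i x, by simp, ?_⟩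
    have : (fun k : ℕ => (k : ℝ)⁻¹ * (((x + k • e i) i.rev : ℤ) : ℝ)) =
        fun k : ℕ => (k : ℝ)⁻¹ * (x i.rev : ℝ) := by
      funext k
      simp [e, rev_ne i]
    rw [this]
    have h := (tendsto_inv_atTop_nhds_zero_nat (𝕜 := ℝ)).mul_const (x i.rev : ℝ)
    rw [zero_mul] at h
    exact h.liminf_eq
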